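/- Let $k\ge 1$ and, for $j\in\{1,\dots,k+1\}$, let $P_j\colon\mathscr F_j\to B(H_j)$ be a projection-valued measure on a measurable space $(\Omega_j,\mathscr F_j)$, where $H_j$ is an arbitrary (not necessarily separable) complex Hilbert space. Let $P=P_1\otimes\cdots\otimes P_{k+1}$ be the tensor product projection-valued measure on $\Omega=\Omega_1\times\cdots\times\Omega_{k+1}$, and write $P_j(f)=\int f\,dP_j$ for measurable, $P_j$-essentially bounded $f$. Let $\varphi\colon\Omega\to\mathbb C$ have an $L^\infty_P$-integral projective decomposition $(\Sigma,\rho,\varphi_1,\dots,\varphi_{k+1})$; that is, $(\Sigma,\rho)$ is a $\sigma$-finite measure space, the functions $\varphi_j\colon\Omega_j\times\Sigma\to\mathbb C$ are measurable, $\varphi_j(\cdot,\sigma)\in L^\infty(\Omega_j,P_j)$ for all $j$ and all $\sigma\in\Sigma$, the upper integral $$\overline{\int_\Sigma}\|\varphi_1(\cdot,\sigma)\|_{L^\infty(P_1)}\cdots\|\varphi_{k+1}(\cdot,\sigma)\|_{L^\infty(P_{k+1})}\,\rho(d\sigma)$$ is finite (the infimum of $\int_\Sigma g\,d\rho$ over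 measurable $g\colon\Sigma\to[0,\infty]$ dominating the integrand $\rho$-a.e.), and $\varphi(\omega)=\int_\Sigma\varphi_1(\omega_1,\sigma)\cdots\varphi_{k+1}(\omega_{k+1},\sigma)\,\rho(d\sigma)$ for $P$-almost every $\omega\in\Omega$. For $b=(b_1,\dots,b_k)\in B(H_2;H_1)\times\cdots\times B(H_{k+1};H_k)$ let $$I^{\boldsymbol P}(\Sigma,\rho,\varphi_1,\dots,\varphi_{k+1})[b]=\int_\Sigma P_1(\varphi_1(\cdot,\sigma))\,b_1\cdots P_k(\varphi_k(\cdot,\sigma))\,b_k\,P_{k+1}(\varphi_{k+1}(\cdot,\sigma))\,\rho(d\sigma)\in B(H_{k+1};H_1)$$ be the pointwise Pettis integral, i.e. the operator $T$ with $\langle Th,h'\rangle=\int_\Sigma\langle F(\sigma)h,h'\rangle\,\rho(d\sigma)$ for all $h\in H_{k+1}$, $h'\in H_1$, where $F(\sigma)$ is the integrand. Then the following hold. 1. For every $b$ this integral exists: $\sigma\mapsto\langle F(\sigma)h,h'\rangle$ is measurable and $\rho$-integrable for all $h,h'$, and an operator $T$ as above exists. 2. Let $b$ be as above, let $b_{k+1}\in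 B(H_1;H_{k+1})$ be of trace class, and let $\gamma$ be a cyclic permutation of $\{1,\dots,k+1\}$, i.e. $\gamma(j)\equiv j+s \pmod{k+1}$ for some $s$. With $\boldsymbol P_\gamma=(P_{\gamma(1)},\dots,P_{\gamma(k+1)})$ and $b_\gamma=(b_{\gamma(1)},\dots,b_{\gamma(k)})$, the integral $I^{\boldsymbol P_\gamma}(\Sigma,\rho,\varphi_{\gamma(1)},\dots,\varphi_{\gamma(k+1)})[b_\gamma]$ exists in the same sense, the two operators below are of trace class, and $$\operatorname{Tr}\big(I^{\boldsymbol P}(\Sigma,\rho,\varphi_1,\dots,\varphi_{k+1})[b]\,b_{k+1}\big)=\operatorname{Tr}\big(I^{\boldsymbol P_\gamma}(\Sigma,\rho,\varphi_{\gamma(1)},\dots,\varphi_{\gamma(k+1)})[b_\gamma]\,b_{\gamma(k+1)}\big).$$ 3. The map $I^{\boldsymbol P}(\Sigma,\rho,\varphi_1,\dots,\varphi_{k+1})\colon B(H_2;H_1)\times\cdots\times B(H_{k+1};H_k)\to B(H_{k+1};H_1)$ is $k$-linear and ultraweakly continuous in each argument, where the ultraweak topology on $B(H;K)$ is the coarsest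 topology making $A\mapsto\operatorname{Tr}(AB)$ continuous for every trace class $B\colon K\to H$. -/

import Mathlib

open MeasureTheory
open scoped ENNReal InnerProductSpace

/-! ### Projection-valued measures

Mathlib's inner product is linear in the second slot, so `⟪k, A h⟫_ℂ` is the number written
`⟨A h, k⟩` when inner products are linear in the first slot. -/

/-- A projection-valued measure on the measurable space `Ω` with values in the bounded operators
on `H`: `P(Ω) = 1`, each `P(G)` is an orthogonal projection, and `P` is countably additive in the
weak operator topology. Only the values at measurable sets matter. -/
structure ProjMeasure (Ω : Type*) [MeasurableSpace Ω] (H : Type*) [NormedAddCommGroup H]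
    [InnerProductSpace ℂ H] [CompleteSpace H] where
  toFun : Set Ω → H →L[ℂ] H
  map_univ : toFun Set.univ = ContinuousLinearMap.id ℂ H
  idem : ∀ G, MeasurableSet G → toFun G ∘L toFun G = toFun G
  selfAdjoint : ∀ G, MeasurableSet G → ContinuousLinearMap.adjoint (toFun G) = toFun G
  hasSum_iUnion : ∀ G : ℕ → Set Ω, (∀ n, MeasurableSet (G n)) →
    Pairwise (Function.onFun Disjoint G) → ∀ h k : H,
      HasSum (fun n => ⟪k, toFun (G n) h⟫_ℂ) ⟪k, toFun (⋃ n, G n) h⟫_ℂ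

namespace ProjMeasure

variable {Ω : Type*} [MeasurableSpace Ω] {H : Type*} [NormedAddCommGroup H]
  [InnerProductSpace ℂ H] [CompleteSpace H]

theorem map_empty (P : ProjMeasure Ω H) : P.toFun ∅ = 0 := by
  ext h
  refine ext_inner_left ℂ fun k => ?_
  have h1 := P.hasSum_iUnion (fun _ => ∅) (fun _ => MeasurableSet.empty)
    (fun _ _ _ => by simp [Function.onFun]) h k
  have h2 := h1.summable
  rw [summable_const_iff] at h2
  simpa using h2

theorem inner_eq (P : ProjMeasure Ω H) {G : Set Ω} (hG : MeasurableSet G) (h : H) :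
    ⟪h, P.toFun G h⟫_ℂ = ((‖P.toFun G h‖ ^ 2 : ℝ) : ℂ) := by
  have h1 : ⟪h, P.toFun G h⟫_ℂ = ⟪P.toFun G h, P.toFun G h⟫_ℂ := by
    conv_lhs => rw [← P.idem G hG, ContinuousLinearMap.comp_apply,
      ← ContinuousLinearMap.adjoint_inner_left, P.selfAdjoint G hG]
  rw [h1, inner_self_eq_norm_sq_to_K]
  norm_cast

/-- The finite positive measure `P_{h,h}(G) = ⟨P(G)h, h⟩`. -/
noncomputable def diag (P : ProjMeasure Ω H) (h : H) : Measure Ω :=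
  Measure.ofMeasurable (fun G _ => ENNReal.ofReal (⟪h, P.toFun G h⟫_ℂ).re)
    (by simp [P.map_empty])
    (by
      intro G hG hd
      have h1 := Complex.hasSum_re (P.hasSum_iUnion G hG hd h h)
      rw [← h1.tsum_eq]
      refine ENNReal.ofReal_tsum_of_nonneg (fun n => ?_) h1.summable
      rw [P.inner_eq (hG n), Complex.ofReal_re]
      positivity)

theorem diag_apply (P : ProjMeasure Ω H) (h : H) {G : Set Ω} (hG : MeasurableSet G) :
    P.diag h G = ENNReal.ofReal (⟪h, P.toFun G h⟫_ℂ).re :=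
  Measure.ofMeasurable_apply G hG

theorem diag_real (P : ProjMeasure Ω H) (h : H) {G : Set Ω} (hG : MeasurableSet G) :
    (((P.diag h).real G : ℝ) : ℂ) = ⟪h, P.toFun G h⟫_ℂ := by
  rw [Measure.real, P.diag_apply h hG, P.inner_eq hG, Complex.ofReal_re,
    ENNReal.toReal_ofReal (by positivity)]

theorem diag_univ (P : ProjMeasure Ω H) (h : H) :
    P.diag h Set.univ = ENNReal.ofReal (‖h‖ ^ 2) := by
  rw [P.diag_apply h MeasurableSet.univ, P.inner_eq MeasurableSet.univ, P.map_univ]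
  simp [-Complex.ofReal_pow]

instance (P : ProjMeasure Ω H) (h : H) : IsFiniteMeasure (P.diag h) :=
  ⟨by rw [P.diag_univ]; exact ENNReal.ofReal_lt_top⟩

theorem diag_eq_zero_iff (P : ProjMeasure Ω H) (h : H) {G : Set Ω} (hG : MeasurableSet G) :
    P.diag h G = 0 ↔ P.toFun G h = 0 := by
  rw [P.diag_apply h hG, P.inner_eq hG, Complex.ofReal_re, ENNReal.ofReal_eq_zero]
  constructor
  · intro h1
    have : ‖P.toFun G h‖ ^ 2 = 0 := le_antisymm h1 (by positivity)
    simpa using this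
  · intro h1
    simp [h1]

/-- The `P`-essential supremum norm `inf {c ≥ 0 : P({|f| > c}) = 0}`, with values in `[0, ∞]`. A
measurable `f` represents an element of `L^∞(Ω, P)` iff this is finite. -/
noncomputable def essNorm (P : ProjMeasure Ω H) (f : Ω → ℂ) : ℝ≥0∞ :=
  sInf {c : ℝ≥0∞ | P.toFun {ω | c < ‖f ω‖ₑ} = 0}

/-- `A` is the integral `∫ f dP`. The condition `⟨A h, h⟩ = ∫ f dP_{h,h}` for all `h` is, by
polarization, the same as `⟨A h, k⟩ = ∫ f dP_{h,k}` for all `h` and `k`. -/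
def IsIntegral (P : ProjMeasure Ω H) (f : Ω → ℂ) (A : H →L[ℂ] H) : Prop :=
  ∀ h : H, ⟪h, A h⟫_ℂ = ∫ ω, f ω ∂(P.diag h)

end ProjMeasure

namespace ProjMeasure

variable {Ω : Type*} [MeasurableSpace Ω] {H : Type*} [NormedAddCommGroup H]
  [InnerProductSpace ℂ H] [CompleteSpace H]

theorem IsIntegral.unique {P : ProjMeasure Ω H} {f : Ω → ℂ} {A B : H →L[ℂ] H}
    (hA : P.IsIntegral f A) (hB : P.IsIntegral f B) : A = B := by
  have h1 : (A : H →ₗ[ℂ] H) = B := by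
    rw [← ext_inner_map]
    intro h
    have h2 := (hA h).trans (hB h).symm
    rw [← inner_conj_symm, ← inner_conj_symm h (B h)] at h2
    exact star_injective h2
  ext h
  exact LinearMap.congr_fun h1 h

set_option linter.unusedSectionVars false in
theorem norm_le_of_quadratic {A : H →L[ℂ] H} {C : ℝ} (hC : 0 ≤ C)
    (hA : ∀ h : H, ‖⟪h, A h⟫_ℂ‖ ≤ C * ‖h‖ ^ 2) : ‖A‖ ≤ 2 * C := by
  have key : ∀ x y : H, ‖⟪A x, y⟫_ℂ‖ ≤ C * (‖x‖ ^ 2 + ‖y‖ ^ 2) := by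
    intro x y
    have hA' : ∀ h : H, ‖⟪A h, h⟫_ℂ‖ ≤ C * ‖h‖ ^ 2 := fun h => by
      rw [norm_inner_symm]; exact hA h
    have h1 := inner_map_polarization' (A : H →ₗ[ℂ] H) x y
    simp only [ContinuousLinearMap.coe_coe] at h1
    have p1 := parallelogram_law_with_norm ℂ x y
    have p2 := parallelogram_law_with_norm ℂ x (Complex.I • y)
    rw [norm_smul, Complex.norm_I, one_mul] at p2
    have e1 := hA' (x + y)
    have e2 := hA' (x - y)
    have e3 := hA' (x + Complex.I • y)
    have e4 := hA' (x - Complex.I • y)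
    rw [h1, norm_div, show ‖(4 : ℂ)‖ = 4 by simp]
    have t : ∀ a b c d : ℂ, ‖a - b - Complex.I * c + Complex.I * d‖
        ≤ ‖a‖ + ‖b‖ + ‖c‖ + ‖d‖ := by
      intro a b c d
      have i1 := norm_add_le (a - b - Complex.I * c) (Complex.I * d)
      have i2 := norm_sub_le (a - b) (Complex.I * c)
      have i3 := norm_sub_le a b
      rw [norm_mul, Complex.norm_I, one_mul] at i1 i2
      linarith
    have t' := t ⟪A (x + y), x + y⟫_ℂ ⟪A (x - y), x - y⟫_ℂ
      ⟪A (x + Complex.I • y), x + Complex.I • y⟫_ℂ ⟪A (x - Complex.I • y), x - Complex.I • y⟫_ℂ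
    rw [div_le_iff₀ (by norm_num)]
    nlinarith [congrArg (C * ·) p1, congrArg (C * ·) p2]
  refine A.opNorm_le_bound (by positivity) fun x => ?_
  by_cases hx : A x = 0
  · rw [hx, norm_zero]; positivity
  have hx' : x ≠ 0 := by rintro rfl; simp at hx
  have n1 : 0 < ‖A x‖ := norm_pos_iff.2 hx
  have n2 : 0 < ‖x‖ := norm_pos_iff.2 hx'
  have h1 := key x (((‖x‖ / ‖A x‖ : ℝ) : ℂ) • A x)
  rw [inner_smul_right, inner_self_eq_norm_sq_to_K, norm_mul, norm_smul, Complex.norm_real,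
    Real.norm_of_nonneg (by positivity), norm_pow, RCLike.norm_ofReal, abs_norm] at h1
  have h2 : ‖x‖ / ‖A x‖ * ‖A x‖ = ‖x‖ := by field_simp
  rw [h2, pow_two, ← mul_assoc, h2] at h1
  have : ‖x‖ * ‖A x‖ ≤ ‖x‖ * (2 * C * ‖x‖) := by nlinarith
  exact le_of_mul_le_mul_left this n2

theorem isIntegral_simpleFunc (P : ProjMeasure Ω H) (g : SimpleFunc Ω ℂ) :
    P.IsIntegral g (∑ c ∈ g.range, c • P.toFun (g ⁻¹' {c})) := by
  intro h
  rw [← SimpleFunc.integral_eq_integral _ (SimpleFunc.integrable_of_isFiniteMeasure _),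
    SimpleFunc.integral_eq]
  simp only [_root_.sum_apply, inner_sum, _root_.smul_apply, inner_smul_right]
  refine Finset.sum_congr rfl fun c _ => ?_
  rw [← P.diag_real h (g.measurableSet_fiber c)]
  simp [mul_comm]

/-- Uniform approximation of a bounded measurable function by simple functions. -/
theorem exists_simpleFunc_near {f : Ω → ℂ} (hf : Measurable f) {C : ℝ} (hC : ∀ ω, ‖f ω‖ ≤ C)
    {ε : ℝ} (hε : 0 < ε) : ∃ g : SimpleFunc Ω ℂ, ∀ ω, ‖f ω - g ω‖ ≤ ε := by
  let r : ℝ → ℝ := fun x => ε / 2 * ⌊x / (ε / 2)⌋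
  have hr : Measurable r := by fun_prop
  have hrb : ∀ x, |x - r x| ≤ ε / 2 := by
    intro x
    have h1 := Int.floor_le (x / (ε / 2))
    have h2 := Int.lt_floor_add_one (x / (ε / 2))
    rw [le_div_iff₀ (by positivity)] at h1
    rw [div_lt_iff₀ (by positivity)] at h2
    rw [abs_le]
    constructor <;> simp only [r] <;> nlinarith
  have hfin : ∀ u : Ω → ℝ, (∀ ω, |u ω| ≤ C) → (Set.range fun ω => r (u ω)).Finite := by
    intro u hu
    refine ((Set.finite_Icc ⌊-C / (ε / 2)⌋ ⌊C / (ε / 2)⌋).image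
      (fun n : ℤ => ε / 2 * (n : ℝ))).subset ?_
    rintro _ ⟨ω, rfl⟩
    refine ⟨⌊u ω / (ε / 2)⌋, ⟨?_, ?_⟩, rfl⟩
    · apply Int.floor_le_floor
      gcongr
      exact (abs_le.1 (hu ω)).1
    · apply Int.floor_le_floor
      gcongr
      exact (abs_le.1 (hu ω)).2
  let g1 : SimpleFunc Ω ℝ := ⟨fun ω => r (f ω).re, fun x =>
    (hr.comp (Complex.measurable_re.comp hf)) (measurableSet_singleton x),
    hfin _ fun ω => (Complex.abs_re_le_norm _).trans (hC ω)⟩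
  let g2 : SimpleFunc Ω ℝ := ⟨fun ω => r (f ω).im, fun x =>
    (hr.comp (Complex.measurable_im.comp hf)) (measurableSet_singleton x),
    hfin _ fun ω => (Complex.abs_im_le_norm _).trans (hC ω)⟩
  refine ⟨(g1.pair g2).map fun p => ⟨p.1, p.2⟩, fun ω => ?_⟩
  refine (Complex.norm_le_abs_re_add_abs_im _).trans ?_
  have h1 := hrb (f ω).re
  have h2 := hrb (f ω).im
  change |(f ω).re - r (f ω).re| + |(f ω).im - r (f ω).im| ≤ ε
  linarith

theorem exists_isIntegral_of_bounded (P : ProjMeasure Ω H) {f : Ω → ℂ} (hf : Measurable f)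
    {C : ℝ} (hC : ∀ ω, ‖f ω‖ ≤ C) : ∃ A, P.IsIntegral f A := by
  have hfi : ∀ h, Integrable f (P.diag h) := fun h =>
    Integrable.of_bound hf.aestronglyMeasurable C (Filter.Eventually.of_forall hC)
  have hg : ∀ n : ℕ, ∃ g : SimpleFunc Ω ℂ, ∀ ω, ‖f ω - g ω‖ ≤ 1 / ((n : ℝ) + 1) := fun n =>
    exists_simpleFunc_near hf hC (by positivity)
  choose g hg using hg
  have hgi : ∀ n h, Integrable (g n) (P.diag h) := fun n h =>
    SimpleFunc.integrable_of_isFiniteMeasure _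
  let A : ℕ → H →L[ℂ] H := fun n => ∑ c ∈ (g n).range, c • P.toFun (g n ⁻¹' {c})
  have hA : ∀ n, P.IsIntegral (g n) (A n) := fun n => P.isIntegral_simpleFunc (g n)
  have hmass : ∀ h, (P.diag h).real Set.univ = ‖h‖ ^ 2 := fun h => by
    rw [Measure.real, P.diag_univ, ENNReal.toReal_ofReal (by positivity)]
  have h0 : Filter.Tendsto (fun n : ℕ => 1 / ((n : ℝ) + 1)) Filter.atTop (nhds 0) :=
    tendsto_one_div_add_atTop_nhds_zero_nat
  have hcauchy : CauchySeq A := by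
    refine cauchySeq_of_le_tendsto_0 (fun n => 2 * (2 * (1 / ((n : ℝ) + 1)))) ?_ ?_
    · intro n m N hn hm
      rw [dist_eq_norm]
      refine norm_le_of_quadratic (by positivity) fun h => ?_
      rw [sub_apply, inner_sub_right, hA n h, hA m h,
        ← integral_sub (hgi n h) (hgi m h), ← hmass h]
      refine norm_integral_le_of_norm_le_const (Filter.Eventually.of_forall fun ω => ?_)
      have e1 : ‖f ω - g n ω‖ ≤ 1 / ((N : ℝ) + 1) := (hg n ω).trans (by gcongr)
      have e2 : ‖f ω - g m ω‖ ≤ 1 / ((N : ℝ) + 1) := (hg m ω).trans (by gcongr)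
      have : g n ω - g m ω = (f ω - g m ω) - (f ω - g n ω) := by ring
      rw [this]
      refine (norm_sub_le _ _).trans (by linarith)
    · simpa using (h0.const_mul 2).const_mul 2
  obtain ⟨B, hB⟩ := cauchySeq_tendsto_of_complete hcauchy
  refine ⟨B, fun h => ?_⟩
  have t1 : Filter.Tendsto (fun n => ⟪h, A n h⟫_ℂ) Filter.atTop (nhds ⟪h, B h⟫_ℂ) :=
    Filter.Tendsto.inner tendsto_const_nhds
      (((ContinuousLinearMap.apply ℂ H h).continuous.tendsto B).comp hB)
  refine tendsto_nhds_unique t1 ?_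
  rw [tendsto_iff_norm_sub_tendsto_zero]
  refine squeeze_zero (fun _ => norm_nonneg _) (fun n => ?_)
    (by simpa using h0.mul_const (‖h‖ ^ 2))
  rw [hA n h, ← integral_sub (hgi n h) (hfi h), ← hmass h]
  refine norm_integral_le_of_norm_le_const (Filter.Eventually.of_forall fun ω => ?_)
  rw [norm_sub_rev]
  simpa using hg n ω

theorem exists_isIntegral (P : ProjMeasure Ω H) {f : Ω → ℂ} (hf : Measurable f)
    (hP : P.essNorm f < ∞) : ∃ A, P.IsIntegral f A := by
  obtain ⟨c, hc, hc'⟩ := sInf_lt_iff.1 hP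
  have hm : MeasurableSet {ω | c < ‖f ω‖ₑ} := measurableSet_lt measurable_const hf.enorm
  obtain ⟨A, hA⟩ := P.exists_isIntegral_of_bounded (hf.indicator hm.compl) (C := c.toReal) (by
    intro ω
    by_cases h : ω ∈ {ω | c < ‖f ω‖ₑ}
    · rw [Set.indicator_of_notMem (by simpa using h), norm_zero]
      exact ENNReal.toReal_nonneg
    · rw [Set.indicator_of_mem (by exact h), ← toReal_enorm]
      exact ENNReal.toReal_mono hc'.ne (not_lt.1 h))
  refine ⟨A, fun h => (hA h).trans (integral_congr_ae ?_)⟩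
  have h0 : P.diag h {ω | c < ‖f ω‖ₑ} = 0 := by
    rw [P.diag_eq_zero_iff h hm, hc]; rfl
  filter_upwards [compl_mem_ae_iff.2 h0] with ω hω
  exact Set.indicator_of_mem hω f

open Classical in
/-- `P(f) = ∫ f dP` for measurable, `P`-essentially bounded `f` (and `0` for other `f`). -/
noncomputable def integral (P : ProjMeasure Ω H) (f : Ω → ℂ) : H →L[ℂ] H :=
  if h : Measurable f ∧ P.essNorm f < ∞ then (P.exists_isIntegral h.1 h.2).choose else 0

theorem isIntegral_integral (P : ProjMeasure Ω H) {f : Ω → ℂ} (hf : Measurable f)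
    (hP : P.essNorm f < ∞) : P.IsIntegral f (P.integral f) := by
  rw [integral, dif_pos ⟨hf, hP⟩]
  exact (P.exists_isIntegral hf hP).choose_spec

end ProjMeasure

/-! ### Null sets of the tensor product of projection-valued measures -/

section TensorProduct

variable {ι : Type*} [Fintype ι] {Ω : ι → Type*} [∀ j, MeasurableSpace (Ω j)]
  {H : ι → Type*} [∀ j, NormedAddCommGroup (H j)] [∀ j, InnerProductSpace ℂ (H j)]
  [∀ j, CompleteSpace (H j)]

/-- `N` is a null set of the tensor product `P = ⨂ j, P j` of projection-valued measures, i.e.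
`P(N) = 0`. Since `⟨P(N) h, h⟩ = (∏ j, (P j)_{h j, h j})(N)` for a pure tensor `h = ⨂ j, h j`, this
says that `N` is a null set of all these product measures; see `isTensorNull_iff`. -/
def IsTensorNull (P : ∀ j, ProjMeasure (Ω j) (H j)) (N : Set (∀ j, Ω j)) : Prop :=
  MeasurableSet N ∧ ∀ h : ∀ j, H j, Measure.pi (fun j => (P j).diag (h j)) N = 0

/-- `Q` is the tensor product of the `P j`, acting on the Hilbert space tensor product `K` of the
`H j`, where `τ h = ⨂ j, h j`. -/
structure IsTensorProjMeasure (P : ∀ j, ProjMeasure (Ω j) (H j)) {K : Type*}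
    [NormedAddCommGroup K] [InnerProductSpace ℂ K] [CompleteSpace K]
    (τ : MultilinearMap ℂ H K) (Q : ProjMeasure (∀ j, Ω j) K) : Prop where
  inner_tprod : ∀ h h' : ∀ j, H j, ⟪τ h, τ h'⟫_ℂ = ∏ j, ⟪h j, h' j⟫_ℂ
  dense_span : Dense (Submodule.span ℂ (Set.range τ) : Set K)
  map_rect : ∀ G : ∀ j, Set (Ω j), (∀ j, MeasurableSet (G j)) → ∀ h : ∀ j, H j,
    Q.toFun (Set.univ.pi G) (τ h) = τ fun j => (P j).toFun (G j) (h j)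

/-- `IsTensorNull` means `P(N) = 0` for the tensor product `P` of the given measures. -/
theorem isTensorNull_iff (P : ∀ j, ProjMeasure (Ω j) (H j)) {K : Type*}
    [NormedAddCommGroup K] [InnerProductSpace ℂ K] [CompleteSpace K]
    {τ : MultilinearMap ℂ H K} {Q : ProjMeasure (∀ j, Ω j) K} (hQ : IsTensorProjMeasure P τ Q)
    {N : Set (∀ j, Ω j)} (hN : MeasurableSet N) : IsTensorNull P N ↔ Q.toFun N = 0 := by
  have key : ∀ h : ∀ j, H j, Measure.pi (fun j => (P j).diag (h j)) = Q.diag (τ h) := by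
    intro h
    refine Measure.pi_eq fun G hG => ?_
    rw [Q.diag_apply _ (MeasurableSet.univ_pi hG), hQ.map_rect G hG, hQ.inner_tprod]
    have e : ∀ j, ⟪h j, (P j).toFun (G j) (h j)⟫_ℂ = ((((P j).diag (h j)).real (G j) : ℝ) : ℂ) :=
      fun j => ((P j).diag_real (h j) (hG j)).symm
    simp only [e]
    rw [← Complex.ofReal_prod, Complex.ofReal_re,
      ENNReal.ofReal_prod_of_nonneg fun _ _ => measureReal_nonneg]
    simp
  simp only [IsTensorNull, hN, true_and, key, Q.diag_eq_zero_iff _ hN]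
  constructor
  · intro h0
    have h1 : Set.EqOn (Q.toFun N) (0 : K →L[ℂ] K) (Submodule.span ℂ (Set.range τ)) := by
      intro x hx
      induction hx using Submodule.span_induction with
      | mem x hx => obtain ⟨h, rfl⟩ := hx; simpa using h0 h
      | zero => simp
      | add x y _ _ hx hy => simp_all
      | smul a x _ hx => simp_all
    exact DFunLike.coe_injective
      (Continuous.ext_on hQ.dense_span (Q.toFun N).continuous (0 : K →L[ℂ] K).continuous h1)
  · intro h0 h
    simp [h0]

end TensorProduct

/-! ### Integral projective decompositions -/

/-- The upper integral of a possibly non-measurable function. -/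
noncomputable def upperIntegral {S : Type*} [MeasurableSpace S] (ρ : Measure S) (g : S → ℝ≥0∞) :
    ℝ≥0∞ :=
  sInf {I | ∃ g' : S → ℝ≥0∞, Measurable g' ∧ (∀ᵐ σ ∂ρ, g σ ≤ g' σ) ∧ I = ∫⁻ σ, g' σ ∂ρ}

/-- `(S, ρ, φ_j)` is an `L^∞_P`-integral projective decomposition of `φ`, where `P = ⨂ j, P j`. In
particular `φ` then lies in the integral projective tensor product of the `L^∞(Ω j, P j)`. -/
structure IsIPD {ι : Type*} [Fintype ι] {Ω : ι → Type*} [∀ j, MeasurableSpace (Ω j)]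
    {H : ι → Type*} [∀ j, NormedAddCommGroup (H j)] [∀ j, InnerProductSpace ℂ (H j)]
    [∀ j, CompleteSpace (H j)] (P : ∀ j, ProjMeasure (Ω j) (H j))
    (φ : (∀ j, Ω j) → ℂ) {S : Type*} [MeasurableSpace S] (ρ : Measure S)
    (φs : ∀ j, Ω j → S → ℂ) : Prop where
  sigmaFinite : SigmaFinite ρ
  measurable : ∀ j, Measurable (fun p : Ω j × S => φs j p.1 p.2)
  essBdd : ∀ j σ, (P j).essNorm (fun ω => φs j ω σ) < ∞
  upperIntegral_lt_top :
    upperIntegral ρ (fun σ => ∏ j, (P j).essNorm (fun ω => φs j ω σ)) < ∞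
  ae_eq : ∃ N, IsTensorNull P N ∧ ∀ ω, ω ∉ N →
    Integrable (fun σ => ∏ j, φs j (ω j) σ) ρ ∧ φ ω = ∫ σ, ∏ j, φs j (ω j) σ ∂ρ

/-! ### Pointwise Pettis integrals -/

/-- `F` is pointwise Pettis integrable with respect to `ρ`, with pointwise Pettis integral `T` over
the whole space. -/
def IsPettisIntegral {S : Type*} [MeasurableSpace S] (ρ : Measure S) {H K : Type*}
    [NormedAddCommGroup H] [InnerProductSpace ℂ H] [NormedAddCommGroup K] [InnerProductSpace ℂ K]
    (F : S → H →L[ℂ] K) (T : H →L[ℂ] K) : Prop :=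
  ∀ (h : H) (k : K), Measurable (fun σ => ⟪k, F σ h⟫_ℂ) ∧ Integrable (fun σ => ⟪k, F σ h⟫_ℂ) ρ ∧
    ⟪k, T h⟫_ℂ = ∫ σ, ⟪k, F σ h⟫_ℂ ∂ρ

open Classical in
/-- The pointwise Pettis integral of `F` over the whole space (`0` if it does not exist). -/
noncomputable def pettisIntegral {S : Type*} [MeasurableSpace S] (ρ : Measure S) {H K : Type*}
    [NormedAddCommGroup H] [InnerProductSpace ℂ H] [NormedAddCommGroup K] [InnerProductSpace ℂ K]
    (F : S → H →L[ℂ] K) : H →L[ℂ] K :=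
  if h : ∃ T, IsPettisIntegral ρ F T then h.choose else 0

/-! ### Trace class operators and the ultraweak topology -/

section Trace

/-- The underlying set of a chosen orthonormal basis of `H`. -/
def onbSet (H : Type*) [NormedAddCommGroup H] [InnerProductSpace ℂ H] [CompleteSpace H] : Set H :=
  (exists_hilbertBasis ℂ H).choose

/-- A chosen orthonormal basis of `H`. -/
noncomputable def onb (H : Type*) [NormedAddCommGroup H] [InnerProductSpace ℂ H]
    [CompleteSpace H] : HilbertBasis (onbSet H) ℂ H :=
  (exists_hilbertBasis ℂ H).choose_spec.choose

variable {H K : Type*} [NormedAddCommGroup H] [InnerProductSpace ℂ H] [CompleteSpace H]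
  [NormedAddCommGroup K] [InnerProductSpace ℂ K] [CompleteSpace K]

/-- `|A| = (A* A)^{1/2}`. -/
noncomputable def absOp (A : H →L[ℂ] K) : H →L[ℂ] H :=
  CFC.sqrt (ContinuousLinearMap.adjoint A ∘L A)

/-- `A ∈ S_1(H; K)`, i.e. `∑ e, ⟨|A| e, e⟩ < ∞` over an orthonormal basis of `H`. -/
def IsTraceClass (A : H →L[ℂ] K) : Prop :=
  Summable fun e : onbSet H => (⟪onb H e, absOp A (onb H e)⟫_ℂ).re

/-- `Tr(A) = ∑ e, ⟨A e, e⟩`, for trace class `A`. -/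
noncomputable def opTrace (A : H →L[ℂ] H) : ℂ :=
  ∑' e : onbSet H, ⟪onb H e, A (onb H e)⟫_ℂ

variable (H K) in
/-- The ultraweak topology on `B(H; K)`: the weak-* topology of `B(H; K) ≅ S_1(K; H)*`, i.e. the
coarsest topology for which `A ↦ Tr(A B)` is continuous for every `B ∈ S_1(K; H)`. -/
noncomputable abbrev ultraweakTopology : TopologicalSpace (H →L[ℂ] K) :=
  ⨅ B : {B : K →L[ℂ] H // IsTraceClass B},
    TopologicalSpace.induced (fun A : H →L[ℂ] K => opTrace (A ∘L B.1)) inferInstance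

end Trace

/-! ### Multiple operator integrals

The index set `{1, …, k+1}` is modelled by `Fin (k + 1)`, whose addition is modulo `k + 1`. -/

section MOI

variable {k : ℕ} {Ω : Fin (k + 1) → Type*} [∀ j, MeasurableSpace (Ω j)]
  {H : Fin (k + 1) → Type*} [∀ j, NormedAddCommGroup (H j)] [∀ j, InnerProductSpace ℂ (H j)]
  [∀ j, CompleteSpace (H j)] {S : Type*} [MeasurableSpace S]

/-- The integrand
`F(σ) = P_1(φ_1(·,σ)) b_1 P_2(φ_2(·,σ)) b_2 ⋯ P_k(φ_k(·,σ)) b_k P_{k+1}(φ_{k+1}(·,σ))`. -/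
noncomputable def moiIntegrand (P : ∀ j, ProjMeasure (Ω j) (H j)) (φs : ∀ j, Ω j → S → ℂ)
    (b : ∀ i : Fin k, H i.succ →L[ℂ] H i.castSucc) (σ : S) : H (Fin.last k) →L[ℂ] H 0 :=
  Fin.induction (motive := fun j => H j →L[ℂ] H 0)
    ((P 0).integral fun ω => φs 0 ω σ)
    (fun i T => T ∘L b i ∘L (P i.succ).integral fun ω => φs i.succ ω σ)
    (Fin.last k)

/-- The decomposition-dependent multiple operator integral `I^P(S, ρ, φ_1, …, φ_{k+1})[b]`. -/
noncomputable def moi (P : ∀ j, ProjMeasure (Ω j) (H j)) (ρ : Measure S)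
    (φs : ∀ j, Ω j → S → ℂ) (b : ∀ i : Fin k, H i.succ →L[ℂ] H i.castSucc) :
    H (Fin.last k) →L[ℂ] H 0 :=
  pettisIntegral ρ (moiIntegrand P φs b)

/-- `γ` is a cyclic permutation of `{1, …, k+1}`, i.e. a rotation `j ↦ j + s` modulo `k + 1`. -/
def IsRotation (γ : Equiv.Perm (Fin (k + 1))) : Prop :=
  ∃ s, ∀ j, γ j = j + s

theorem IsRotation.map_add_one {γ : Equiv.Perm (Fin (k + 1))} (hγ : IsRotation γ)
    (j : Fin (k + 1)) : γ (j + 1) = γ j + 1 := by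
  obtain ⟨s, hs⟩ := hγ
  rw [hs, hs, add_right_comm]

/-- The operators `b_1, …, b_k` and `b_{k+1}` as one family `b_i : H_{i+1} → H_i`, indexed by
`i ∈ {1, …, k+1}` with `i + 1` taken modulo `k + 1`. To avoid type casts, `i + 1` is given as an
index `j` with a proof of `j = i + 1`. -/
def cyclicOp (b : ∀ i : Fin k, H i.succ →L[ℂ] H i.castSucc) (b' : H 0 →L[ℂ] H (Fin.last k))
    (i j : Fin (k + 1)) (hij : j = i + 1) : H j →L[ℂ] H i :=
  Fin.lastCases (motive := fun i => ∀ j, j = i + 1 → (H j →L[ℂ] H i))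
    (fun j h => (show 0 = j from (h.trans (Fin.last_add_one k)).symm) ▸ b')
    (fun i j h => (show i.succ = j from (h.trans (Fin.coeSucc_eq_succ)).symm) ▸ b i)
    i j hij

set_option linter.unusedSectionVars false in
theorem cyclicOp_castSucc (b : ∀ i : Fin k, H i.succ →L[ℂ] H i.castSucc)
    (b' : H 0 →L[ℂ] H (Fin.last k)) (i : Fin k) :
    cyclicOp b b' i.castSucc i.succ Fin.coeSucc_eq_succ.symm = b i := by
  simp [cyclicOp]

set_option linter.unusedSectionVars false in
theorem cyclicOp_last (b : ∀ i : Fin k, H i.succ →L[ℂ] H i.castSucc)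
    (b' : H 0 →L[ℂ] H (Fin.last k)) :
    cyclicOp b b' (Fin.last k) 0 (Fin.last_add_one k).symm = b' := by
  simp [cyclicOp]

/-- The permuted operators `b_γ = (b_{γ(1)}, …, b_{γ(k)})`. -/
def permOps (b : ∀ i : Fin k, H i.succ →L[ℂ] H i.castSucc) (b' : H 0 →L[ℂ] H (Fin.last k))
    {γ : Equiv.Perm (Fin (k + 1))} (hγ : IsRotation γ) (i : Fin k) :
    H (γ i.succ) →L[ℂ] H (γ i.castSucc) :=
  cyclicOp b b' (γ i.castSucc) (γ i.succ)
    (by rw [← hγ.map_add_one, Fin.coeSucc_eq_succ])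

/-- The last permuted operator `b_{γ(k+1)}`. -/
def permOpLast (b : ∀ i : Fin k, H i.succ →L[ℂ] H i.castSucc) (b' : H 0 →L[ℂ] H (Fin.last k))
    {γ : Equiv.Perm (Fin (k + 1))} (hγ : IsRotation γ) : H (γ 0) →L[ℂ] H (γ (Fin.last k)) :=
  cyclicOp b b' (γ (Fin.last k)) (γ 0)
    (by rw [← hγ.map_add_one, Fin.last_add_one])

end MOI

/-! ### Integrals against projection-valued measures depending on a parameter -/

namespace ProjMeasure

variable {Ω : Type*} [MeasurableSpace Ω] {H : Type*} [NormedAddCommGroup H]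
  [InnerProductSpace ℂ H] [CompleteSpace H]

/-! Put `Q j σ = P_j(φ_j(·, σ))`. Two facts about these families drive everything: `σ ↦ Q j σ h` is
strongly measurable for each vector `h` (`stronglyMeasurable_integral`), and `∏ j, ‖Q j σ‖` is
dominated a.e. by an integrable function (`exists_integrable_prod_norm_integral_le`). Hence each
vector `F σ h` has a Bochner integral, and these integrals define the Pettis integral.

For the trace, split the integrand at its `i`-th operator as `C σ ∘L X ∘L A σ`, with `X` the
operator in slot `i`. If `B` is of trace class, then `Tr((∫ C X A) B) = ∫ Tr(C X A B) = ∫ Tr(X A B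
C) = Tr(X ∫ A B C)`, and `∫ A B C` is again of trace class. This is `opTrace_pettis_comp`. With `X =
b i` and `B = b'`, the product `A B C` is the integrand of a rotated problem, which gives cyclic
invariance. With `X` variable, the functional `Tr(· B)` pulls back to `Tr(· W)` with `W = ∫ A B C`
of trace class, which is ultraweak continuity.

The delicate point is exchanging trace and integral when the orthonormal basis is uncountable. A
trace class operator is a series `∑ ⟨·, x n⟩ y n` with `∑ ‖x n‖ ‖y n‖ < ∞`, and each `σ ↦ L σ (y n)`
has separable range, so only countably many basis vectors contribute
(`IsPettisIntegral.opTrace_eq`). -/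

theorem diag_real_univ (P : ProjMeasure Ω H) (h : H) :
    (P.diag h).real Set.univ = ‖h‖ ^ 2 := by
  rw [Measure.real, P.diag_univ, ENNReal.toReal_ofReal (by positivity)]

theorem isIntegral_indicator (P : ProjMeasure Ω H) {G : Set Ω} (hG : MeasurableSet G) :
    P.IsIntegral (G.indicator 1) (P.toFun G) := fun h => by
  rw [integral_indicator hG, ← P.diag_real h hG]
  simp

theorem IsIntegral.add {P : ProjMeasure Ω H} {f g : Ω → ℂ} {A B : H →L[ℂ] H}
    (hA : P.IsIntegral f A) (hB : P.IsIntegral g B) (hf : ∀ h, Integrable f (P.diag h))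
    (hg : ∀ h, Integrable g (P.diag h)) : P.IsIntegral (fun ω => f ω + g ω) (A + B) := fun h => by
  rw [integral_add (hf h) (hg h), add_apply, inner_add_right, hA h, hB h]

theorem IsIntegral.sub {P : ProjMeasure Ω H} {f g : Ω → ℂ} {A B : H →L[ℂ] H}
    (hA : P.IsIntegral f A) (hB : P.IsIntegral g B) (hf : ∀ h, Integrable f (P.diag h))
    (hg : ∀ h, Integrable g (P.diag h)) : P.IsIntegral (fun ω => f ω - g ω) (A - B) := fun h => by
  rw [integral_sub (hf h) (hg h), sub_apply, inner_sub_right, hA h, hB h]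

theorem IsIntegral.const_mul {P : ProjMeasure Ω H} {f : Ω → ℂ} {A : H →L[ℂ] H}
    (hA : P.IsIntegral f A) (c : ℂ) : P.IsIntegral (fun ω => c * f ω) (c • A) := fun h => by
  rw [integral_const_mul, smul_apply, inner_smul_right, hA h]

theorem IsIntegral.congr {P : ProjMeasure Ω H} {f g : Ω → ℂ} {A : H →L[ℂ] H}
    (hA : P.IsIntegral f A) (hfg : ∀ h, f =ᵐ[P.diag h] g) : P.IsIntegral g A := fun h => by
  rw [hA h, integral_congr_ae (hfg h)]

/-- The factor 2 comes from polarization: only the quadratic form of `A` is controlled directly. The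
sharp constant is not needed, since only integrability of a dominating function matters later. -/
theorem IsIntegral.norm_le {P : ProjMeasure Ω H} {f : Ω → ℂ} {A : H →L[ℂ] H}
    (hA : P.IsIntegral f A) {C : ℝ} (hC : 0 ≤ C) (hf : ∀ h, ∀ᵐ ω ∂P.diag h, ‖f ω‖ ≤ C) :
    ‖A‖ ≤ 2 * C :=
  norm_le_of_quadratic hC fun h => by
    rw [hA h, ← P.diag_real_univ h]
    exact norm_integral_le_of_norm_le_const (hf h)

theorem integrable_indicator_one (P : ProjMeasure Ω H) {G : Set Ω} (hG : MeasurableSet G) (h : H) :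
    Integrable (G.indicator (1 : Ω → ℂ)) (P.diag h) :=
  (integrable_const (1 : ℂ)).indicator hG

theorem toFun_diff (P : ProjMeasure Ω H) {F G : Set Ω} (hF : MeasurableSet F)
    (hG : MeasurableSet G) (hGF : G ⊆ F) : P.toFun (F \ G) = P.toFun F - P.toFun G := by
  refine (P.isIntegral_indicator (hF.diff hG)).unique ?_
  rw [Set.indicator_sdiff hGF]
  exact (P.isIntegral_indicator hF).sub (P.isIntegral_indicator hG)
    (P.integrable_indicator_one hF) (P.integrable_indicator_one hG)

theorem toFun_union (P : ProjMeasure Ω H) {F G : Set Ω} (hF : MeasurableSet F)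
    (hG : MeasurableSet G) (hFG : Disjoint F G) : P.toFun (F ∪ G) = P.toFun F + P.toFun G := by
  refine (P.isIntegral_indicator (hF.union hG)).unique ?_
  rw [Set.indicator_union_of_disjoint hFG]
  exact (P.isIntegral_indicator hF).add (P.isIntegral_indicator hG)
    (P.integrable_indicator_one hF) (P.integrable_indicator_one hG)

/-- Countable additivity in the strong operator topology. -/
theorem tendsto_sum_toFun (P : ProjMeasure Ω H) {G : ℕ → Set Ω} (hG : ∀ n, MeasurableSet (G n))
    (hd : Pairwise (Function.onFun Disjoint G)) (h : H) :
    Filter.Tendsto (fun n => ∑ i ∈ Finset.range n, P.toFun (G i) h) Filter.atTop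
      (nhds (P.toFun (⋃ n, G n) h)) := by
  have hU : ∀ n : ℕ, MeasurableSet (⋃ i ∈ Finset.range n, G i) := fun n =>
    Finset.measurableSet_biUnion _ fun i _ => hG i
  have hsum : ∀ n, P.toFun (⋃ i ∈ Finset.range n, G i) = ∑ i ∈ Finset.range n, P.toFun (G i) := by
    intro n
    induction n with
    | zero => simp [P.map_empty]
    | succ n ih =>
      rw [Finset.sum_range_succ, ← ih, ← P.toFun_union (hU n) (hG n)]
      · rw [Finset.range_add_one, Finset.set_biUnion_insert, Set.union_comm]
      · simp only [Set.disjoint_iUnion_left, Finset.mem_range]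
        exact fun i hi => hd hi.ne
  have hV : MeasurableSet (⋃ n, G n) := MeasurableSet.iUnion hG
  have hUV : ∀ n : ℕ, (⋃ i ∈ Finset.range n, G i) ⊆ ⋃ n, G n := fun n =>
    Set.iUnion₂_subset fun i _ => Set.subset_iUnion G i
  -- The remainder is a projection applied to `h`, so its squared norm is a value of the quadratic
  -- form. This upgrades weak convergence to norm convergence.
  have h1 : ∀ n : ℕ, ‖P.toFun (⋃ n, G n) h - ∑ i ∈ Finset.range n, P.toFun (G i) h‖ ^ 2 =
      (⟪h, P.toFun (⋃ n, G n) h⟫_ℂ - ∑ i ∈ Finset.range n, ⟪h, P.toFun (G i) h⟫_ℂ).re := by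
    intro n
    have e1 : P.toFun (⋃ n, G n) h - ∑ i ∈ Finset.range n, P.toFun (G i) h =
        P.toFun ((⋃ n, G n) \ ⋃ i ∈ Finset.range n, G i) h := by
      rw [P.toFun_diff hV (hU n) (hUV n), hsum]
      simp
    rw [← inner_sum, ← inner_sub_right, e1, P.inner_eq (hV.diff (hU n)), Complex.ofReal_re]
  rw [tendsto_iff_norm_sub_tendsto_zero]
  have h2 := (P.hasSum_iUnion G hG hd h h).tendsto_sum_nat.const_sub ⟪h, P.toFun (⋃ n, G n) h⟫_ℂ
  rw [sub_self] at h2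
  have h3 := (Complex.continuous_re.tendsto _).comp h2
  have h4 := (Real.continuous_sqrt.tendsto _).comp h3
  simp only [Complex.zero_re, Real.sqrt_zero] at h4
  refine h4.congr fun n => ?_
  simp only [Function.comp_apply]
  rw [← h1, Real.sqrt_sq (norm_nonneg _), norm_sub_rev]

variable {S : Type*} [MeasurableSpace S]

/-- Dynkin's π-λ argument starting from measurable rectangles. Disjoint unions need countable
additivity in norm: in a nonseparable `H`, weak measurability would not give strong measurability.
-/
theorem stronglyMeasurable_toFun_section (P : ProjMeasure Ω H) (h : H) {E : Set (Ω × S)}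
    (hE : MeasurableSet E) :
    StronglyMeasurable fun σ => P.toFun ((fun ω => (ω, σ)) ⁻¹' E) h := by
  have hsec : ∀ {F : Set (Ω × S)}, MeasurableSet F → ∀ σ : S,
      MeasurableSet ((fun ω => (ω, σ)) ⁻¹' F) := fun hF σ => measurable_prodMk_right hF
  induction E, hE using MeasurableSpace.induction_on_inter
    generateFrom_prod.symm isPiSystem_prod with
  | empty => simpa [P.map_empty] using stronglyMeasurable_const
  | basic E hE =>
    obtain ⟨A, hA, B, hB, rfl⟩ := hE
    have : (fun σ => P.toFun ((fun ω => (ω, σ)) ⁻¹' (A ×ˢ B)) h) =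
        B.indicator fun _ => P.toFun A h := by
      ext1 σ
      by_cases hσ : σ ∈ B
      · simp [Set.mk_preimage_prod_left, hσ]
      · simp [Set.mk_preimage_prod_left_eq_empty, hσ, P.map_empty]
    rw [this]
    exact stronglyMeasurable_const.indicator hB
  | compl E hE ih =>
    have : (fun σ => P.toFun ((fun ω => (ω, σ)) ⁻¹' Eᶜ) h) =
        fun σ => h - P.toFun ((fun ω => (ω, σ)) ⁻¹' E) h := by
      ext1 σ
      rw [Set.preimage_compl, Set.compl_eq_univ_sdiff, P.toFun_diff MeasurableSet.univ (hsec hE σ)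
        (Set.subset_univ _), P.map_univ]
      rfl
    rw [this]
    exact stronglyMeasurable_const.sub ih
  | iUnion E hd hE ih =>
    refine stronglyMeasurable_of_tendsto Filter.atTop
      (f := fun n σ => ∑ i ∈ Finset.range n, P.toFun ((fun ω => (ω, σ)) ⁻¹' E i) h)
      (fun n => Finset.stronglyMeasurable_fun_sum _ fun i _ => ih i) ?_
    rw [tendsto_pi_nhds]
    intro σ
    rw [Set.preimage_iUnion]
    exact P.tendsto_sum_toFun (fun n => hsec (hE n) σ)
      (fun i j hij => (hd hij).preimage _) h

theorem integrable_section (P : ProjMeasure Ω H) (g : SimpleFunc (Ω × S) ℂ) (σ : S) (h : H) :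
    Integrable (fun ω => g (ω, σ)) (P.diag h) :=
  (g.comp (fun ω => (ω, σ)) measurable_prodMk_right).integrable_of_isFiniteMeasure

theorem exists_integral_section_simpleFunc (P : ProjMeasure Ω H) (g : SimpleFunc (Ω × S) ℂ) :
    ∃ A : S → H →L[ℂ] H, (∀ σ, P.IsIntegral (fun ω => g (ω, σ)) (A σ)) ∧
      ∀ h, StronglyMeasurable fun σ => A σ h := by
  induction g using SimpleFunc.induction with
  | const c hE =>
    rename_i E
    refine ⟨fun σ => c • P.toFun ((fun ω => (ω, σ)) ⁻¹' E), fun σ => ?_, fun h =>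
      (P.stronglyMeasurable_toFun_section h hE).const_smul c⟩
    refine ((P.isIntegral_indicator (measurable_prodMk_right hE)).const_mul c).congr fun h =>
      Filter.Eventually.of_forall fun ω => ?_
    classical
    by_cases hω : (ω, σ) ∈ E <;> simp [Set.indicator, hω, Set.piecewise]
  | @add f g _ hf hg =>
    obtain ⟨A, hA, hA'⟩ := hf
    obtain ⟨B, hB, hB'⟩ := hg
    exact ⟨fun σ => A σ + B σ, fun σ => (hA σ).add (hB σ) (P.integrable_section f σ)
      (P.integrable_section g σ), fun h => (hA' h).add (hB' h)⟩

theorem exists_integral_section_of_bounded (P : ProjMeasure Ω H) {f : Ω × S → ℂ}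
    (hf : Measurable f) {C : ℝ} (hC : ∀ p, ‖f p‖ ≤ C) :
    ∃ A : S → H →L[ℂ] H, (∀ σ, P.IsIntegral (fun ω => f (ω, σ)) (A σ)) ∧
      ∀ h, StronglyMeasurable fun σ => A σ h := by
  have hfm : ∀ σ, Measurable fun ω => f (ω, σ) := fun σ => hf.comp measurable_prodMk_right
  have hfi : ∀ σ h, Integrable (fun ω => f (ω, σ)) (P.diag h) := fun σ h =>
    Integrable.of_bound (hfm σ).aestronglyMeasurable C (Filter.Eventually.of_forall fun ω => hC _)
  choose A hA using fun σ => P.exists_isIntegral_of_bounded (hfm σ) (fun ω => hC (ω, σ))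
  have hg : ∀ n : ℕ, ∃ g : SimpleFunc (Ω × S) ℂ, ∀ p, ‖f p - g p‖ ≤ 1 / ((n : ℝ) + 1) := fun n =>
    exists_simpleFunc_near hf hC (by positivity)
  choose g hg using hg
  choose B hB hB' using fun n => P.exists_integral_section_simpleFunc (g n)
  refine ⟨A, hA, fun h => stronglyMeasurable_of_tendsto Filter.atTop (hB' · h) ?_⟩
  rw [tendsto_pi_nhds]
  intro σ
  have h0 : Filter.Tendsto (fun n : ℕ => 2 * (1 / ((n : ℝ) + 1)) * ‖h‖) Filter.atTop (nhds 0) := by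
    simpa using (tendsto_one_div_add_atTop_nhds_zero_nat.const_mul (2 : ℝ)).mul_const ‖h‖
  rw [tendsto_iff_norm_sub_tendsto_zero]
  refine squeeze_zero (fun _ => norm_nonneg _) (fun n => ?_) h0
  rw [norm_sub_rev, ← sub_apply]
  refine (ContinuousLinearMap.le_opNorm _ _).trans ?_
  gcongr
  exact ((hA σ).sub (hB n σ) (hfi σ) (P.integrable_section (g n) σ)).norm_le (by positivity)
    fun h => Filter.Eventually.of_forall fun ω => hg n (ω, σ)

theorem ae_enorm_le (P : ProjMeasure Ω H) {f : Ω → ℂ} (hf : Measurable f) {c : ℝ≥0∞}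
    (hc : P.toFun {ω | c < ‖f ω‖ₑ} = 0) (h : H) : ∀ᵐ ω ∂P.diag h, ‖f ω‖ₑ ≤ c := by
  have h0 : P.diag h {ω | c < ‖f ω‖ₑ} = 0 := by
    rw [P.diag_eq_zero_iff h (measurableSet_lt measurable_const hf.enorm), hc]; rfl
  filter_upwards [compl_mem_ae_iff.2 h0] with ω hω
  exact not_lt.1 hω

/-- Every admissible level `c` in the infimum defining the essential norm bounds the integrand
almost everywhere for all diagonal measures at once. -/
theorem enorm_integral_le (P : ProjMeasure Ω H) {f : Ω → ℂ} (hf : Measurable f)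
    (hP : P.essNorm f < ∞) : ‖P.integral f‖ₑ ≤ 2 * P.essNorm f := by
  have key : ∀ c : ℝ≥0∞, P.toFun {ω | c < ‖f ω‖ₑ} = 0 → ‖P.integral f‖ₑ ≤ 2 * c := by
    intro c hc
    by_cases hc' : c = ∞
    · simp [hc']
    have h1 := (P.isIntegral_integral hf hP).norm_le (C := c.toReal) ENNReal.toReal_nonneg
      fun h => by
        filter_upwards [P.ae_enorm_le hf hc h] with ω hω
        rw [← toReal_enorm]
        exact ENNReal.toReal_mono hc' hω
    rw [← ofReal_norm]
    refine (ENNReal.ofReal_le_ofReal h1).trans ?_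
    rw [ENNReal.ofReal_mul (by norm_num), ENNReal.ofReal_toReal hc']
    simp
  have h2 : ‖P.integral f‖ₑ / 2 ≤ P.essNorm f :=
    le_sInf fun c hc => ENNReal.div_le_of_le_mul' (key c hc)
  rwa [ENNReal.div_le_iff_le_mul (by simp) (by simp), mul_comm] at h2

/-- Truncating to `{‖f‖ ≤ n}` gives jointly bounded functions. No bound uniform in `σ` is available,
but for each fixed `σ` the truncation is eventually harmless because the section is essentially
bounded. -/
theorem stronglyMeasurable_integral (P : ProjMeasure Ω H) {f : Ω → S → ℂ}
    (hf : Measurable fun p : Ω × S => f p.1 p.2) (hP : ∀ σ, P.essNorm (fun ω => f ω σ) < ∞)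
    (h : H) : StronglyMeasurable fun σ => P.integral (fun ω => f ω σ) h := by
  have hfm : ∀ σ, Measurable fun ω => f ω σ := fun σ => hf.comp measurable_prodMk_right
  have hE : ∀ n : ℕ, MeasurableSet {p : Ω × S | ‖f p.1 p.2‖ ≤ n} := fun n =>
    measurableSet_le hf.norm measurable_const
  choose A hA hA' using fun n : ℕ => P.exists_integral_section_of_bounded (C := n)
    (hf.indicator (hE n)) (by
      intro p
      by_cases hp : p ∈ {p : Ω × S | ‖f p.1 p.2‖ ≤ n}
      · rw [Set.indicator_of_mem hp]; exact hp
      · rw [Set.indicator_of_notMem hp]; simp)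
  refine stronglyMeasurable_of_tendsto Filter.atTop (hA' · h) ?_
  rw [tendsto_pi_nhds]
  intro σ
  obtain ⟨c, hc, hc'⟩ := sInf_lt_iff.1 (hP σ)
  refine tendsto_const_nhds.congr' ?_
  filter_upwards [Filter.eventually_ge_atTop ⌈c.toReal⌉₊] with n hn
  congr 1
  refine ((P.isIntegral_integral (hfm σ) (hP σ)).congr fun h => ?_).unique (hA n σ)
  filter_upwards [P.ae_enorm_le (hfm σ) hc h] with ω hω
  have : (ω, σ) ∈ {p : Ω × S | ‖f p.1 p.2‖ ≤ n} := by
    have h1 : ‖f ω σ‖ ≤ c.toReal := by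
      rw [← toReal_enorm]
      exact ENNReal.toReal_mono hc'.ne hω
    exact h1.trans (Nat.ceil_le.1 hn)
  rw [Set.indicator_of_mem this]

end ProjMeasure

/-! ### Strong measurability of composed operator families -/

section OperatorFamilies

variable {S : Type*} [MeasurableSpace S] {H K : Type*} [NormedAddCommGroup H]
  [InnerProductSpace ℂ H] [NormedAddCommGroup K] [InnerProductSpace ℂ K]

theorem stronglyMeasurable_apply {A : S → H →L[ℂ] K} (hA : ∀ h, StronglyMeasurable fun σ => A σ h)
    {v : S → H} (hv : StronglyMeasurable v) : StronglyMeasurable fun σ => A σ (v σ) := by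
  refine stronglyMeasurable_of_tendsto Filter.atTop (f := fun n σ => A σ (hv.approx n σ))
    (fun n => ?_) (tendsto_pi_nhds.2 fun σ =>
      ((A σ).continuous.tendsto _).comp (hv.tendsto_approx σ))
  generalize hv.approx n = w
  induction w using SimpleFunc.induction with
  | const c hE =>
    rename_i E
    have : (fun σ => A σ (SimpleFunc.piecewise E hE (SimpleFunc.const S c)
        (SimpleFunc.const S 0) σ)) = E.indicator fun σ => A σ c := by
      ext1 σ
      by_cases hσ : σ ∈ E <;> simp [hσ]
    rw [this]
    exact (hA c).indicator hE
  | add _ hf hg =>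
    simp only [SimpleFunc.coe_add, Pi.add_apply, map_add]
    exact hf.add hg

end OperatorFamilies

/-! ### Nuclear representations of trace class operators -/

section Nuclear

open ContinuousLinearMap

set_option linter.unusedSectionVars false

variable {H K G : Type*} [NormedAddCommGroup H] [InnerProductSpace ℂ H] [CompleteSpace H]
  [NormedAddCommGroup K] [InnerProductSpace ℂ K] [CompleteSpace K]
  [NormedAddCommGroup G] [InnerProductSpace ℂ G] [CompleteSpace G]

/-- `T = ∑ n, ⟨·, x n⟩ y n`, where `∑ n, ‖x n‖ ‖y n‖ < ∞`. -/
structure NuclearRep (T : H →L[ℂ] K) (x : ℕ → H) (y : ℕ → K) : Prop where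
  summable : Summable fun n => ‖x n‖ * ‖y n‖
  hasSum : ∀ z, HasSum (fun n => ⟪x n, z⟫_ℂ • y n) (T z)

theorem NuclearRep.comp_left {T : H →L[ℂ] K} {x : ℕ → H} {y : ℕ → K} (hT : NuclearRep T x y)
    (L : K →L[ℂ] G) : NuclearRep (L ∘L T) x (fun n => L (y n)) where
  summable := Summable.of_nonneg_of_le (fun n => by positivity)
    (fun n => (mul_le_mul_of_nonneg_left (L.le_opNorm (y n)) (norm_nonneg _)).trans
      (le_of_eq (by ring))) (hT.summable.mul_left ‖L‖)
  hasSum z := by simpa using (hT.hasSum z).mapL L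

theorem NuclearRep.comp_right {T : H →L[ℂ] K} {x : ℕ → H} {y : ℕ → K} (hT : NuclearRep T x y)
    (R : G →L[ℂ] H) : NuclearRep (T ∘L R) (fun n => adjoint R (x n)) y where
  summable := Summable.of_nonneg_of_le (fun n => by positivity)
    (fun n => (mul_le_mul_of_nonneg_right ((adjoint R).le_opNorm (x n)) (norm_nonneg _)).trans
      (le_of_eq (mul_assoc _ _ _))) (hT.summable.mul_left ‖adjoint R‖)
  hasSum z := by simpa [adjoint_inner_left] using hT.hasSum (R z)

/-- Cauchy–Schwarz followed by Bessel's inequality for each factor. -/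
theorem sum_norm_inner_mul_norm_inner_le {ι : Type*} {e : ι → H} (he : Orthonormal ℂ e)
    (s : Finset ι) (x y : H) :
    ∑ i ∈ s, ‖⟪x, e i⟫_ℂ‖ * ‖⟪e i, y⟫_ℂ‖ ≤ ‖x‖ * ‖y‖ := by
  simp only [norm_inner_symm x]
  refine (Real.sum_mul_le_sqrt_mul_sqrt _ _ _).trans ?_
  gcongr <;> refine Real.sqrt_le_iff.2 ⟨norm_nonneg _, he.sum_inner_products_le _⟩

theorem NuclearRep.hasSum_inner {T : H →L[ℂ] K} {x : ℕ → H} {y : ℕ → K} (hT : NuclearRep T x y)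
    (w : K) (z : H) : HasSum (fun n => ⟪x n, z⟫_ℂ * ⟪w, y n⟫_ℂ) ⟪w, T z⟫_ℂ := by
  simpa [inner_smul_right] using (hT.hasSum z).mapL (innerSL ℂ w)

theorem NuclearRep.sum_norm_inner_le {T : H →L[ℂ] H} {x y : ℕ → H} (hT : NuclearRep T x y)
    {ι : Type*} {e : ι → H} (he : Orthonormal ℂ e) (s : Finset ι) :
    ∑ i ∈ s, ‖⟪e i, T (e i)⟫_ℂ‖ ≤ ∑' n, ‖x n‖ * ‖y n‖ := by
  have hs : ∀ i, Summable fun n => ‖⟪x n, e i⟫_ℂ‖ * ‖⟪e i, y n⟫_ℂ‖ := fun i =>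
    Summable.of_nonneg_of_le (fun n => by positivity) (fun n => by
      simpa using sum_norm_inner_mul_norm_inner_le he {i} (x n) (y n)) hT.summable
  calc ∑ i ∈ s, ‖⟪e i, T (e i)⟫_ℂ‖
      ≤ ∑ i ∈ s, ∑' n, ‖⟪x n, e i⟫_ℂ‖ * ‖⟪e i, y n⟫_ℂ‖ := by
        refine Finset.sum_le_sum fun i _ => ?_
        rw [← (hT.hasSum_inner (e i) (e i)).tsum_eq]
        simp only [← norm_mul] at hs ⊢
        exact norm_tsum_le_tsum_norm (hs i)
    _ = ∑' n, ∑ i ∈ s, ‖⟪x n, e i⟫_ℂ‖ * ‖⟪e i, y n⟫_ℂ‖ :=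
        (Summable.tsum_finsetSum fun i _ => hs i).symm
    _ ≤ ∑' n, ‖x n‖ * ‖y n‖ :=
        Summable.tsum_le_tsum (fun n => sum_norm_inner_mul_norm_inner_le he s (x n) (y n))
          (summable_sum fun i _ => hs i) hT.summable

/-- A bound for the trace norm of `L T R` which is uniform in `L` and `R`. -/
theorem NuclearRep.sum_norm_inner_comp_le {T : H →L[ℂ] K} {x : ℕ → H} {y : ℕ → K}
    (hT : NuclearRep T x y) (L : K →L[ℂ] G) (R : G →L[ℂ] H)
    {ι : Type*} {e : ι → G} (he : Orthonormal ℂ e) (s : Finset ι) :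
    ∑ i ∈ s, ‖⟪e i, L (T (R (e i)))⟫_ℂ‖ ≤ (∑' n, ‖x n‖ * ‖y n‖) * (‖L‖ * ‖R‖) := by
  refine (((hT.comp_left L).comp_right R).sum_norm_inner_le he s).trans ?_
  rw [← tsum_mul_right]
  refine Summable.tsum_le_tsum (fun n => ?_) ((hT.comp_left L).comp_right R).summable
    (hT.summable.mul_right _)
  have h1 := (adjoint R).le_opNorm (x n)
  have h2 := L.le_opNorm (y n)
  rw [LinearIsometryEquiv.norm_map] at h1
  calc ‖adjoint R (x n)‖ * ‖L (y n)‖ ≤ (‖R‖ * ‖x n‖) * (‖L‖ * ‖y n‖) := by gcongr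
    _ = _ := by ring

/-- Bessel makes the double series over `n` and the basis absolutely summable; after exchanging the
sums, Parseval evaluates the inner one. The right-hand side does not involve the basis. -/
theorem NuclearRep.opTrace_eq {T : H →L[ℂ] H} {x y : ℕ → H} (hT : NuclearRep T x y) :
    opTrace T = ∑' n, ⟪x n, y n⟫_ℂ := by
  have hs : Summable fun p : ℕ × onbSet H => ⟪x p.1, onb H p.2⟫_ℂ * ⟪onb H p.2, y p.1⟫_ℂ := by
    refine Summable.of_norm ?_
    rw [summable_prod_of_nonneg fun _ => norm_nonneg _]
    have h1 : ∀ n, ∀ s : Finset (onbSet H),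
        ∑ e ∈ s, ‖⟪x n, onb H e⟫_ℂ * ⟪onb H e, y n⟫_ℂ‖ ≤ ‖x n‖ * ‖y n‖ := fun n s => by
      simp only [norm_mul]
      exact sum_norm_inner_mul_norm_inner_le (onb H).orthonormal s (x n) (y n)
    refine ⟨fun n => summable_of_sum_le (fun _ => norm_nonneg _) (h1 n), ?_⟩
    exact Summable.of_nonneg_of_le (fun n => tsum_nonneg fun _ => norm_nonneg _)
      (fun n => Real.tsum_le_of_sum_le (fun _ => norm_nonneg _) (h1 n)) hT.summable
  calc opTrace T = ∑' e : onbSet H, ∑' n, ⟪x n, onb H e⟫_ℂ * ⟪onb H e, y n⟫_ℂ :=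
        tsum_congr fun e => (hT.hasSum_inner _ _).tsum_eq.symm
    _ = ∑' n, ∑' e : onbSet H, ⟪x n, onb H e⟫_ℂ * ⟪onb H e, y n⟫_ℂ :=
        Summable.tsum_comm (f := fun n e => ⟪x n, onb H e⟫_ℂ * ⟪onb H e, y n⟫_ℂ) hs
    _ = _ := tsum_congr fun n => (onb H).tsum_inner_mul_inner (x n) (y n)

/-- Both traces are the series `∑ ⟪x n, R (y n)⟫`. -/
theorem NuclearRep.opTrace_comp_comm {T : H →L[ℂ] K} {x : ℕ → H} {y : ℕ → K}
    (hT : NuclearRep T x y) (R : K →L[ℂ] H) : opTrace (T ∘L R) = opTrace (R ∘L T) := by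
  rw [(hT.comp_left R).opTrace_eq, (hT.comp_right R).opTrace_eq]
  simp only [adjoint_inner_left]

/-- The assignment `B z ↦ A z` is a well-defined contraction on the range of `B`; it extends to the
closure, and then by zero to the orthogonal complement. Applied to `A` and `absOp A` in both orders,
this replaces the polar decomposition. -/
theorem exists_eq_comp_of_norm_le {A : H →L[ℂ] K} {B : H →L[ℂ] G} (h : ∀ z, ‖A z‖ ≤ ‖B z‖) :
    ∃ C : G →L[ℂ] K, ‖C‖ ≤ 1 ∧ A = C ∘L B := by
  let E := B.range.topologicalClosure
  let e : H →ₗ[ℂ] E := (B : H →ₗ[ℂ] G).codRestrict E fun z =>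
    B.range.le_topologicalClosure ⟨z, rfl⟩
  have he : DenseRange e := by
    intro v
    rw [closure_subtype]
    refine closure_mono ?_ v.2
    rintro _ ⟨z, rfl⟩
    exact ⟨e z, ⟨z, rfl⟩, rfl⟩
  have hn : ∀ z, ‖(A : H →ₗ[ℂ] K) z‖ ≤ 1 * ‖e z‖ := fun z => by rw [one_mul]; exact h z
  let C := (A : H →ₗ[ℂ] K).extendOfNorm e
  refine ⟨C ∘L E.orthogonalProjectionOnto, ?_, ?_⟩
  · refine (opNorm_comp_le _ _).trans (mul_le_one₀ ?_ (norm_nonneg _)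
      E.orthogonalProjectionOnto_norm_le)
    exact LinearMap.opNorm_extendOfNorm_le he zero_le_one hn
  · ext z
    have h1 : E.orthogonalProjectionOnto (B z) = e z :=
      E.orthogonalProjectionOnto_mem_subspace_eq_self (e z)
    rw [comp_apply, comp_apply, h1]
    exact (LinearMap.extendOfNorm_eq he ⟨1, hn⟩ z).symm

theorem absOp_nonneg (A : H →L[ℂ] K) : 0 ≤ absOp A := CFC.sqrt_nonneg _

theorem norm_absOp_apply (A : H →L[ℂ] K) (z : H) : ‖absOp A z‖ = ‖A z‖ := by
  have h1 : absOp A * absOp A = adjoint A ∘L A :=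
    CFC.sqrt_mul_sqrt_self _ ((nonneg_iff_isPositive _).2 (isPositive_adjoint_comp_self A))
  have h2 : adjoint (absOp A) = absOp A := (absOp_nonneg A).isSelfAdjoint
  have h3 : ⟪absOp A z, absOp A z⟫_ℂ = ⟪A z, A z⟫_ℂ := by
    rw [← adjoint_inner_right, ← adjoint_inner_right, h2]
    exact congrArg (fun B : H →L[ℂ] H => ⟪z, B z⟫_ℂ) h1
  rw [inner_self_eq_norm_sq_to_K, inner_self_eq_norm_sq_to_K] at h3
  have h4 : ‖absOp A z‖ ^ 2 = ‖A z‖ ^ 2 := by exact_mod_cast h3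
  exact (pow_left_inj₀ (norm_nonneg _) (norm_nonneg _) two_ne_zero).1 h4

/-- Since `absOp A = V ∘L A` for a contraction `V`, the trace of `absOp A` is among the tested sums.
Unlike `absOp`, the tested expressions are linear in `A`, so they can be estimated under an
integral. -/
theorem isTraceClass_of_sum_norm_inner_le {A : H →L[ℂ] K} {M : ℝ}
    (hM : ∀ V : K →L[ℂ] H, ‖V‖ ≤ 1 → ∀ s : Finset (onbSet H),
      ∑ e ∈ s, ‖⟪onb H e, V (A (onb H e))⟫_ℂ‖ ≤ M) : IsTraceClass A := by
  obtain ⟨V, hV, hVA⟩ := exists_eq_comp_of_norm_le (A := absOp A) (B := A)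
    fun z => (norm_absOp_apply A z).le
  have hpos : (absOp A).IsPositive := (nonneg_iff_isPositive _).1 (absOp_nonneg A)
  refine summable_of_sum_le (fun e => hpos.re_inner_nonneg_right _) fun s =>
    (Finset.sum_le_sum fun e _ => ?_).trans (hM V hV s)
  rw [hVA]
  exact (Complex.re_le_norm _)

theorem NuclearRep.isTraceClass {A : H →L[ℂ] K} {x : ℕ → H} {y : ℕ → K} (hA : NuclearRep A x y) :
    IsTraceClass A :=
  isTraceClass_of_sum_norm_inner_le fun V hV s =>
    (hA.sum_norm_inner_comp_le V (ContinuousLinearMap.id ℂ H) (onb H).orthonormal s).trans <|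
      mul_le_mul_of_nonneg_left
        (mul_le_one₀ hV (norm_nonneg _) ContinuousLinearMap.norm_id_le)
        (tsum_nonneg fun n => by positivity)

/-- A summable family has countable support; the support is embedded in `ℕ` and the remaining terms
are set to zero. This passes from a possibly uncountable orthonormal basis to sequences. -/
theorem exists_nuclearRep_of_hasSum {A : H →L[ℂ] K} {ι : Type*} {x : ι → H} {y : ι → K}
    (hs : Summable fun i => ‖x i‖ * ‖y i‖) (hA : ∀ z, HasSum (fun i => ⟪x i, z⟫_ℂ • y i) (A z)) :
    ∃ x y, NuclearRep A x y := by
  have : Countable (Function.support fun i => ‖x i‖ * ‖y i‖) := hs.countable_support.to_subtype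
  obtain ⟨f, hf⟩ := exists_injective_nat (Function.support fun i => ‖x i‖ * ‖y i‖)
  refine ⟨Function.extend f (fun i => x i) 0, Function.extend f (fun i => y i) 0, ?_, fun z => ?_⟩
  · rw [← hf.summable_iff]
    · refine (hs.subtype _).congr fun i => ?_
      simp [hf.extend_apply]
    · intro n hn
      simp [Function.extend_apply' _ _ _ hn]
  · rw [← hf.hasSum_iff]
    · have h1 := (hasSum_subtype_iff_of_support_subset (s := Function.support fun i => ‖x i‖ * ‖y i‖)
        (f := fun i => ⟪x i, z⟫_ℂ • y i) (by
          intro i hi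
          contrapose! hi
          simp only [Function.mem_support, not_not, mul_eq_zero, norm_eq_zero] at hi ⊢
          rcases hi with hi | hi <;> simp [hi])).2 (hA z)
      convert h1 using 1
      ext i
      simp [hf.extend_apply]
    · intro n hn
      simp [Function.extend_apply' _ _ _ hn]

/-- Write `A = U R R` with `R` the square root of `absOp A` and `U` a contraction, and expand `R z`
in the basis. Then `x e = R e` and `y e = U (R e)`, and `∑ ‖R e‖ ^ 2` is the trace of `absOp A`. -/
theorem IsTraceClass.exists_nuclearRep {A : H →L[ℂ] K} (hA : IsTraceClass A) :
    ∃ x y, NuclearRep A x y := by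
  obtain ⟨U, hU, hUA⟩ := exists_eq_comp_of_norm_le (A := A) (B := absOp A)
    fun z => (norm_absOp_apply A z).ge
  let R := CFC.sqrt (absOp A)
  have h1 : R * R = absOp A := CFC.sqrt_mul_sqrt_self _ (absOp_nonneg A)
  have h2 : adjoint R = R := (CFC.sqrt_nonneg (absOp A)).isSelfAdjoint
  have hsum : Summable fun e : onbSet H => ‖R (onb H e)‖ ^ 2 := by
    refine hA.congr fun e => ?_
    rw [← h1, mul_apply_eq_comp, ← adjoint_inner_left, h2, inner_self_eq_norm_sq_to_K]
    norm_cast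
  refine exists_nuclearRep_of_hasSum (x := fun e : onbSet H => R (onb H e))
    (y := fun e => U (R (onb H e))) ?_ fun z => ?_
  · refine Summable.of_nonneg_of_le (fun e => by positivity) (fun e => ?_) hsum
    rw [pow_two]
    gcongr
    exact (U.le_of_opNorm_le hU _).trans (one_mul _).le
  · have h3 := ((onb H).hasSum_repr (R z)).mapL (U ∘L R)
    have h4 : (U ∘L R) (R z) = A z := by
      rw [hUA, ← h1]; rfl
    rw [h4] at h3
    convert h3 using 2 with e
    rw [map_smul, (onb H).repr_apply_apply, ← adjoint_inner_left, h2]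
    rfl

end Nuclear

/-! ### Traces of pointwise Pettis integrals -/

section PettisTrace

open ContinuousLinearMap

/-- Each vector of a countable set whose closure contains `s` has countably many nonzero
coefficients. A basis vector orthogonal to that whole set is orthogonal to its closure. -/
theorem HilbertBasis.countable_inner_ne_zero {ι H : Type*} [NormedAddCommGroup H]
    [InnerProductSpace ℂ H] [CompleteSpace H] (b : HilbertBasis ι ℂ H) {s : Set H}
    (hs : TopologicalSpace.IsSeparable s) : {i | ∃ v ∈ s, ⟪b i, v⟫_ℂ ≠ 0}.Countable := by
  obtain ⟨c, hc, hsc⟩ := hs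
  refine (hc.biUnion fun v _ => (b.summable_inner_mul_inner v v).countable_support).mono ?_
  rintro i ⟨v, hv, hi⟩
  by_contra hi'
  simp only [Set.mem_iUnion, Function.mem_support, ne_eq, mul_eq_zero, not_or, not_exists,
    not_and, not_not] at hi'
  refine hi (closure_minimal (t := {v | ⟪b i, v⟫_ℂ = 0}) (fun w hw => ?_)
    (isClosed_eq (by fun_prop) continuous_const) (hsc hv))
  by_contra hw'
  exact hw' (hi' w hw fun h => hw' (inner_eq_zero_symm.1 h))

variable {S : Type*} [MeasurableSpace S] {ρ : Measure S}
variable {H K G G' : Type*} [NormedAddCommGroup H] [InnerProductSpace ℂ H]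
  [NormedAddCommGroup K] [InnerProductSpace ℂ K]
  [NormedAddCommGroup G] [InnerProductSpace ℂ G]
  [NormedAddCommGroup G'] [InnerProductSpace ℂ G']

theorem IsPettisIntegral.unique {F : S → H →L[ℂ] K} {T T' : H →L[ℂ] K}
    (hT : IsPettisIntegral ρ F T) (hT' : IsPettisIntegral ρ F T') : T = T' := by
  ext h
  exact ext_inner_left ℂ fun k => (hT h k).2.2.trans (hT' h k).2.2.symm

theorem IsPettisIntegral.comp_right {F : S → H →L[ℂ] K} {T : H →L[ℂ] K}
    (hT : IsPettisIntegral ρ F T) (R : G →L[ℂ] H) :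
    IsPettisIntegral ρ (fun σ => F σ ∘L R) (T ∘L R) := fun h k => hT (R h) k

theorem IsPettisIntegral.comp_left [CompleteSpace K] [CompleteSpace G] {F : S → H →L[ℂ] K}
    {T : H →L[ℂ] K} (hT : IsPettisIntegral ρ F T) (L : K →L[ℂ] G) :
    IsPettisIntegral ρ (fun σ => L ∘L F σ) (L ∘L T) := fun h k => by
  simpa only [comp_apply, adjoint_inner_left] using hT h (adjoint L k)

theorem IsPettisIntegral.add {F F' : S → H →L[ℂ] K} {T T' : H →L[ℂ] K}
    (hT : IsPettisIntegral ρ F T) (hT' : IsPettisIntegral ρ F' T') :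
    IsPettisIntegral ρ (fun σ => F σ + F' σ) (T + T') := fun h k => by
  obtain ⟨m, i, e⟩ := hT h k
  obtain ⟨m', i', e'⟩ := hT' h k
  simp only [add_apply, inner_add_right]
  exact ⟨m.add m', i.add i', by rw [e, e', integral_add i i']⟩

theorem IsPettisIntegral.smul {F : S → H →L[ℂ] K} {T : H →L[ℂ] K}
    (hT : IsPettisIntegral ρ F T) (c : ℂ) :
    IsPettisIntegral ρ (fun σ => c • F σ) (c • T) := fun h k => by
  obtain ⟨m, i, e⟩ := hT h k
  simp only [smul_apply, inner_smul_right]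
  exact ⟨m.const_mul c, i.const_mul c, by rw [e, integral_const_mul]⟩

/-- The operator is `h ↦ ∫ F σ h`, a Bochner integral for each `h`; domination by `g` bounds its
norm by `∫ g`. -/
theorem isPettisIntegral_pettisIntegral [CompleteSpace K] {F : S → H →L[ℂ] K}
    (hF : ∀ h, StronglyMeasurable fun σ => F σ h) {g : S → ℝ} (hg : Integrable g ρ)
    (hle : ∀ᵐ σ ∂ρ, ‖F σ‖ ≤ g σ) : IsPettisIntegral ρ F (pettisIntegral ρ F) := by
  have hle' : ∀ h, ∀ᵐ σ ∂ρ, ‖F σ h‖ ≤ g σ * ‖h‖ := fun h => by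
    filter_upwards [hle] with σ hσ using (F σ).le_of_opNorm_le hσ h
  have hi : ∀ h, Integrable (fun σ => F σ h) ρ := fun h =>
    (hg.mul_const ‖h‖).mono' (hF h).aestronglyMeasurable (hle' h)
  have hex : ∃ T, IsPettisIntegral ρ F T := by
    let T₀ : H →ₗ[ℂ] K :=
      { toFun h := ∫ σ, F σ h ∂ρ
        map_add' h h' := by simp only [map_add]; exact integral_add (hi h) (hi h')
        map_smul' c h := by simp only [map_smul, RingHom.id_apply]; exact integral_smul c _ }
    refine ⟨T₀.mkContinuous (∫ σ, g σ ∂ρ) fun h => ?_, fun h k => ⟨?_, ?_, ?_⟩⟩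
    · rw [← integral_mul_const]
      exact norm_integral_le_of_norm_le (hg.mul_const ‖h‖) (hle' h)
    · exact (stronglyMeasurable_const.inner (hF h)).measurable
    · exact (hi h).const_inner k
    · exact (integral_inner (hi h) k).symm
  rw [pettisIntegral, dif_pos hex]
  exact hex.choose_spec

variable [CompleteSpace H] [CompleteSpace K] [CompleteSpace G] [CompleteSpace G']

/-- The pointwise trace norm estimate, integrated. The bound depends neither on `e` nor on the
finite set `s`, so it yields both the trace class property and the summability needed to exchange
trace and integral. -/
theorem IsPettisIntegral.sum_norm_inner_le {D : H →L[ℂ] K} {x : ℕ → H} {y : ℕ → K}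
    (hD : NuclearRep D x y) {L : S → K →L[ℂ] G} {R : S → G →L[ℂ] H} {g : S → ℝ}
    (hg : Integrable g ρ) (hle : ∀ᵐ σ ∂ρ, ‖L σ‖ * ‖R σ‖ ≤ g σ) {T : G →L[ℂ] G}
    (hT : IsPettisIntegral ρ (fun σ => L σ ∘L D ∘L R σ) T)
    {ι : Type*} {e : ι → G} (he : Orthonormal ℂ e) (s : Finset ι) :
    ∑ i ∈ s, ∫ σ, ‖⟪e i, L σ (D (R σ (e i)))⟫_ℂ‖ ∂ρ ≤ ∫ σ, (∑' n, ‖x n‖ * ‖y n‖) * g σ ∂ρ := by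
  have hi : ∀ i ∈ s, Integrable (fun σ => ‖⟪e i, L σ (D (R σ (e i)))⟫_ℂ‖) ρ := fun i _ =>
    (hT (e i) (e i)).2.1.norm
  rw [← integral_finsetSum _ hi]
  refine integral_mono_ae (integrable_finsetSum _ hi)
    (hg.const_mul _) ?_
  filter_upwards [hle] with σ hσ
  refine (hD.sum_norm_inner_comp_le (L σ) (R σ) he s).trans ?_
  gcongr

/-- A pointwise Pettis integral of `L(σ) D R(σ)` is of trace class if `D` is. -/
theorem IsPettisIntegral.isTraceClass {D : H →L[ℂ] K} (hD : IsTraceClass D)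
    {L : S → K →L[ℂ] G} {R : S → G' →L[ℂ] H} {g : S → ℝ} (hg : Integrable g ρ)
    (hle : ∀ᵐ σ ∂ρ, ‖L σ‖ * ‖R σ‖ ≤ g σ) {T : G' →L[ℂ] G}
    (hT : IsPettisIntegral ρ (fun σ => L σ ∘L D ∘L R σ) T) : IsTraceClass T := by
  obtain ⟨x, y, hxy⟩ := hD.exists_nuclearRep
  refine isTraceClass_of_sum_norm_inner_le (M := ∫ σ, (∑' n, ‖x n‖ * ‖y n‖) * g σ ∂ρ)
    fun V hV s => ?_
  -- The test contraction is absorbed into the left factor, which does not spoil the domination by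
  -- `g`.
  have hVT := hT.comp_left V
  refine (Finset.sum_le_sum fun e _ => ?_).trans
    (IsPettisIntegral.sum_norm_inner_le hxy (L := fun σ => V ∘L L σ) hg ?_ hVT
      (onb G').orthonormal s)
  · have h1 := (hVT (onb G' e) (onb G' e)).2.2
    simp only [comp_apply] at h1 ⊢
    rw [h1]
    exact norm_integral_le_integral_norm _
  · filter_upwards [hle] with σ hσ
    refine le_trans ?_ hσ
    gcongr
    exact (opNorm_comp_le _ _).trans (mul_le_of_le_one_left (norm_nonneg _) hV)

theorem IsPettisIntegral.opTrace_eq {D : H →L[ℂ] K} (hD : IsTraceClass D)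
    {L : S → K →L[ℂ] G} (hL : ∀ z, StronglyMeasurable fun σ => L σ z)
    {R : S → G →L[ℂ] H} {g : S → ℝ} (hg : Integrable g ρ)
    (hle : ∀ᵐ σ ∂ρ, ‖L σ‖ * ‖R σ‖ ≤ g σ) {T : G →L[ℂ] G}
    (hT : IsPettisIntegral ρ (fun σ => L σ ∘L D ∘L R σ) T) :
    opTrace T = ∫ σ, opTrace (L σ ∘L D ∘L R σ) ∂ρ := by
  obtain ⟨x, y, hxy⟩ := hD.exists_nuclearRep
  -- The basis vectors not orthogonal to every `L σ (y n)`. Since `D z` is a series in the `y n`,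
  -- all diagonal matrix entries vanish outside `N`; countability of `N` permits exchanging sum and
  -- integral.
  let N : Set (onbSet G) := ⋃ n, {e | ∃ v ∈ Set.range fun σ => L σ (y n), ⟪onb G e, v⟫_ℂ ≠ 0}
  have hN : N.Countable := Set.countable_iUnion fun n =>
    (onb G).countable_inner_ne_zero (hL (y n)).isSeparable_range
  have hzero : ∀ e ∉ N, ∀ σ z, ⟪onb G e, L σ (D z)⟫_ℂ = 0 := by
    intro e he σ z
    simp only [N, Set.mem_iUnion, Set.mem_ofPred_eq, Set.exists_range_iff, not_exists,
      not_not] at he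
    have h1 := (hxy.comp_left (L σ)).hasSum_inner (onb G e) z
    simp only [he, mul_zero] at h1
    exact (h1.unique hasSum_zero)
  have : Countable N := hN.to_subtype
  have hsupp : ∀ B : G →L[ℂ] G, (∀ e ∉ N, ⟪onb G e, B (onb G e)⟫_ℂ = 0) →
      opTrace B = ∑' e : N, ⟪onb G e, B (onb G e)⟫_ℂ := fun B hB =>
    (tsum_subtype_eq_of_support_subset fun e he => by_contra fun h => he (hB e h)).symm
  have hTe : ∀ e, ⟪onb G e, T (onb G e)⟫_ℂ = ∫ σ, ⟪onb G e, L σ (D (R σ (onb G e)))⟫_ℂ ∂ρ :=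
    fun e => (hT (onb G e) (onb G e)).2.2
  rw [hsupp T fun e he => by simp [hTe, hzero e he]]
  simp only [fun σ => hsupp (L σ ∘L D ∘L R σ) fun e he => hzero e he σ _, hTe]
  refine (hasSum_integral_of_summable_integral_norm
    (fun e : N => (hT (onb G e) (onb G e)).2.1) ?_).tsum_eq
  refine summable_of_sum_le (fun e => integral_nonneg fun _ => norm_nonneg _) fun s =>
    IsPettisIntegral.sum_norm_inner_le hxy hg hle hT
      ((onb G).orthonormal.comp ((↑) : N → onbSet G) Subtype.val_injective) s

/-- `Tr((∫ C(σ) X A(σ) dρ) B) = Tr(X ∫ A(σ) B C(σ) dρ)` for trace class `B`. -/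
theorem opTrace_pettis_comp {C : S → H →L[ℂ] G} {A : S → G' →L[ℂ] K}
    (hC : ∀ z, StronglyMeasurable fun σ => C σ z) (hA : ∀ z, StronglyMeasurable fun σ => A σ z)
    {g : S → ℝ} (hg : Integrable g ρ) (hle : ∀ᵐ σ ∂ρ, ‖C σ‖ * ‖A σ‖ ≤ g σ)
    (X : K →L[ℂ] H) {B : G →L[ℂ] G'} (hB : IsTraceClass B) {T : G' →L[ℂ] G}
    (hT : IsPettisIntegral ρ (fun σ => C σ ∘L X ∘L A σ) T) {W : H →L[ℂ] K}
    (hW : IsPettisIntegral ρ (fun σ => A σ ∘L B ∘L C σ) W) :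
    opTrace (T ∘L B) = opTrace (X ∘L W) := by
  obtain ⟨x, y, hxy⟩ := hB.exists_nuclearRep
  have hle' : ∀ᵐ σ ∂ρ, ‖C σ ∘L X ∘L A σ‖ * ‖ContinuousLinearMap.id ℂ G‖ ≤ ‖X‖ * g σ := by
    filter_upwards [hle] with σ hσ
    calc _ ≤ (‖C σ‖ * (‖X‖ * ‖A σ‖)) * 1 := by
          gcongr
          · exact (opNorm_comp_le _ _).trans (by gcongr; exact opNorm_comp_le _ _)
          · exact norm_id_le
      _ = ‖X‖ * (‖C σ‖ * ‖A σ‖) := by ring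
      _ ≤ _ := by gcongr
  have hle'' : ∀ᵐ σ ∂ρ, ‖X ∘L A σ‖ * ‖C σ‖ ≤ ‖X‖ * g σ := by
    filter_upwards [hle] with σ hσ
    calc _ ≤ (‖X‖ * ‖A σ‖) * ‖C σ‖ := by gcongr; exact opNorm_comp_le _ _
      _ = ‖X‖ * (‖C σ‖ * ‖A σ‖) := by ring
      _ ≤ _ := by gcongr
  -- Both traces move under the integral with `D = B`; on the left all other factors precede `B`, so
  -- the right factor is the identity. Pointwise, it remains to commute `C σ` with `X ∘L A σ ∘L B`.
  rw [IsPettisIntegral.opTrace_eq hB (L := fun σ => C σ ∘L X ∘L A σ)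
      (R := fun _ => ContinuousLinearMap.id ℂ G)
      (fun z => stronglyMeasurable_apply hC (X.continuous.comp_stronglyMeasurable (hA z)))
      (hg.const_mul ‖X‖) hle' (hT.comp_right B),
    IsPettisIntegral.opTrace_eq hB (L := fun σ => X ∘L A σ)
      (fun z => X.continuous.comp_stronglyMeasurable (hA z)) (hg.const_mul ‖X‖) hle''
      (hW.comp_left X)]
  exact integral_congr_ae (Filter.Eventually.of_forall fun σ =>
    ((hxy.comp_left (X ∘L A σ)).opTrace_comp_comm (C σ)).symm)

end PettisTrace

/-! ### Products of operators along consecutive indices modulo `k + 1` -/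

section Chains

open ContinuousLinearMap

set_option linter.unusedSectionVars false

variable {k : ℕ} {H : Fin (k + 1) → Type*} [∀ j, NormedAddCommGroup (H j)]
  [∀ j, InnerProductSpace ℂ (H j)] [∀ j, CompleteSpace (H j)] {S : Type*}

/-- `IsCyclicProd Q β n i j T` means that `T = Q_i β_{i,i+1} Q_{i+1} ⋯ β_{j-1,j} Q_j`, where `j = i + n`
modulo `k + 1`. -/
inductive IsCyclicProd (Q : ∀ j, S → H j →L[ℂ] H j) (β : ∀ i j, j = i + 1 → (H j →L[ℂ] H i)) :
    ℕ → ∀ i j, (S → H j →L[ℂ] H i) → Prop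
  | single (i : Fin (k + 1)) : IsCyclicProd Q β 0 i i (Q i)
  | step {n : ℕ} {i j : Fin (k + 1)} {T : S → H j →L[ℂ] H i} (hT : IsCyclicProd Q β n i j T)
      (j' : Fin (k + 1)) (h : j' = j + 1) :
      IsCyclicProd Q β (n + 1) i j' fun σ => T σ ∘L β j j' h ∘L Q j' σ

variable {Q : ∀ j, S → H j →L[ℂ] H j} {β : ∀ i j, j = i + 1 → (H j →L[ℂ] H i)}

/-- The last step determines the previous index by cancelling `+ 1`. Identifying products through
this relation avoids transporting operators along equalities of indices. -/
theorem IsCyclicProd.unique {n : ℕ} {i j : Fin (k + 1)} {T T' : S → H j →L[ℂ] H i}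
    (hT : IsCyclicProd Q β n i j T) (hT' : IsCyclicProd Q β n i j T') : T = T' := by
  induction hT with
  | single i => cases hT'; rfl
  | @step n i j T hT j' h ih =>
    cases hT' with
    | @step _ _ l T' hT' _ h' =>
      obtain rfl : j = l := add_right_cancel (h.symm.trans h')
      rw [ih hT']

theorem IsCyclicProd.trans {m n : ℕ} {i l l' j : Fin (k + 1)} {C : S → H l →L[ℂ] H i}
    {A : S → H j →L[ℂ] H l'} (hC : IsCyclicProd Q β m i l C) (h : l' = l + 1)
    (hA : IsCyclicProd Q β n l' j A) :
    IsCyclicProd Q β (m + n + 1) i j fun σ => C σ ∘L β l l' h ∘L A σ := by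
  induction hA with
  | single l' => exact hC.step l' h
  | step _ j' h' ih => exact (ih h).step j' h'

theorem IsCyclicProd.stronglyMeasurable [MeasurableSpace S] {n : ℕ} {i j : Fin (k + 1)}
    {T : S → H j →L[ℂ] H i} (hT : IsCyclicProd Q β n i j T)
    (hQ : ∀ j h, StronglyMeasurable fun σ => Q j σ h) (h : H j) :
    StronglyMeasurable fun σ => T σ h := by
  induction hT with
  | single i => exact hQ i h
  | @step n i j T hT j' hj ih =>
    exact stronglyMeasurable_apply ih ((β j j' hj).continuous.comp_stronglyMeasurable (hQ j' h))

/-- The product `Q_0 b_0 Q_1 b_1 ⋯ b_{j-1} Q_j`. -/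
noncomputable def partialProd (Q : ∀ j, S → H j →L[ℂ] H j)
    (b : ∀ i : Fin k, H i.succ →L[ℂ] H i.castSucc) (j : Fin (k + 1)) (σ : S) : H j →L[ℂ] H 0 :=
  Fin.induction (motive := fun j => H j →L[ℂ] H 0) (Q 0 σ)
    (fun i T => T ∘L b i ∘L Q i.succ σ) j

theorem partialProd_succ (b : ∀ i : Fin k, H i.succ →L[ℂ] H i.castSucc) (i : Fin k) (σ : S) :
    partialProd Q b i.succ σ = partialProd Q b i.castSucc σ ∘L b i ∘L Q i.succ σ :=
  rfl

theorem prod_Iic_succ {M : Type*} [CommMonoid M] (f : Fin (k + 1) → M) (i : Fin k) :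
    ∏ l ∈ Finset.Iic i.succ, f l = (∏ l ∈ Finset.Iic i.castSucc, f l) * f i.succ := by
  have : Finset.Iic i.succ = insert i.succ (Finset.Iic i.castSucc) := by
    ext l
    simp only [Finset.mem_Iic, Finset.mem_insert, Fin.le_def, Fin.ext_iff, Fin.val_succ,
      Fin.val_castSucc]
    omega
  rw [this, Finset.prod_insert (by simp [Fin.le_def]), mul_comm]

theorem exists_norm_partialProd_le (Q : ∀ j, S → H j →L[ℂ] H j)
    (b : ∀ i : Fin k, H i.succ →L[ℂ] H i.castSucc) (j : Fin (k + 1)) :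
    ∃ M : ℝ, 0 ≤ M ∧ ∀ σ, ‖partialProd Q b j σ‖ ≤ M * ∏ l ∈ Finset.Iic j, ‖Q l σ‖ := by
  induction j using Fin.induction with
  | zero =>
    refine ⟨1, zero_le_one, fun σ => ?_⟩
    have : Finset.Iic (0 : Fin (k + 1)) = {0} := by ext; simp
    rw [this, Finset.prod_singleton, one_mul]
    rfl
  | succ i ih =>
    obtain ⟨M, hM, hle⟩ := ih
    refine ⟨M * ‖b i‖, by positivity, fun σ => ?_⟩
    rw [partialProd_succ, prod_Iic_succ]
    calc _ ≤ ‖partialProd Q b i.castSucc σ‖ * (‖b i‖ * ‖Q i.succ σ‖) :=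
          (opNorm_comp_le _ _).trans (by gcongr; exact opNorm_comp_le _ _)
      _ ≤ (M * ∏ l ∈ Finset.Iic i.castSucc, ‖Q l σ‖) * (‖b i‖ * ‖Q i.succ σ‖) := by
          gcongr; exact hle σ
      _ = _ := by ring

/-- A rotation preserves successors, so a rotated integrand is a cyclic product of the original data
that starts at `γ 0`. -/
theorem isCyclicProd_partialProd_perm (Q : ∀ j, S → H j →L[ℂ] H j)
    (b : ∀ i : Fin k, H i.succ →L[ℂ] H i.castSucc)
    (b' : H 0 →L[ℂ] H (Fin.last k)) {γ : Equiv.Perm (Fin (k + 1))} (hγ : IsRotation γ)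
    (j : Fin (k + 1)) : IsCyclicProd Q (cyclicOp b b') j (γ 0) (γ j)
      (partialProd (H := fun j => H (γ j)) (fun j => Q (γ j)) (permOps b b' hγ) j) := by
  induction j using Fin.induction with
  | zero => exact .single (γ 0)
  | succ i ih => exact ih.step (γ i.succ) (by rw [← hγ.map_add_one, Fin.coeSucc_eq_succ])

theorem isCyclicProd_partialProd (Q : ∀ j, S → H j →L[ℂ] H j)
    (b : ∀ i : Fin k, H i.succ →L[ℂ] H i.castSucc) (b' : H 0 →L[ℂ] H (Fin.last k))
    (j : Fin (k + 1)) : IsCyclicProd Q (cyclicOp b b') j 0 j (partialProd Q b j) := by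
  induction j using Fin.induction with
  | zero => exact .single 0
  | succ i ih =>
    have h1 := ih.step i.succ Fin.coeSucc_eq_succ.symm
    rw [cyclicOp_castSucc] at h1
    exact h1

theorem partialProd_update_of_le (b : ∀ i : Fin k, H i.succ →L[ℂ] H i.castSucc) (i : Fin k)
    (X : H i.succ →L[ℂ] H i.castSucc) {j : Fin (k + 1)} (hj : j ≤ i.castSucc) (σ : S) :
    partialProd Q (Function.update b i X) j σ = partialProd Q b j σ := by
  induction j using Fin.induction with
  | zero => rfl
  | succ j ih =>
    have hji : j < i := by
      rw [Fin.le_def, Fin.val_succ, Fin.val_castSucc] at hj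
      exact Fin.lt_def.2 hj
    rw [partialProd_succ, partialProd_succ, Function.update_of_ne hji.ne,
      ih (Fin.castSucc_le_castSucc_iff.2 hji.le)]

/-- The dependence of a product on its `i`-th factor. -/
theorem exists_partialProd_update_eq (Q : ∀ j, S → H j →L[ℂ] H j)
    (b : ∀ i : Fin k, H i.succ →L[ℂ] H i.castSucc) (b' : H 0 →L[ℂ] H (Fin.last k)) (i : Fin k)
    {j : Fin (k + 1)} (hj : i.succ ≤ j) :
    ∃ (n : ℕ) (A : S → H j →L[ℂ] H i.succ) (M : ℝ), n + i + 1 = j ∧ 0 ≤ M ∧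
      IsCyclicProd Q (cyclicOp b b') n i.succ j A ∧
      (∀ σ, ‖partialProd Q b i.castSucc σ‖ * ‖A σ‖ ≤ M * ∏ l ∈ Finset.Iic j, ‖Q l σ‖) ∧
      ∀ X σ, partialProd Q (Function.update b i X) j σ =
        partialProd Q b i.castSucc σ ∘L X ∘L A σ := by
  induction j using Fin.induction with
  | zero => simp at hj
  | succ j ih =>
    obtain hij | hij := (Fin.succ_le_succ_iff.1 hj).eq_or_lt
    · subst hij
      obtain ⟨M, hM, hle⟩ := exists_norm_partialProd_le Q b i.castSucc
      refine ⟨0, Q i.succ, M, by simp, hM, .single _, fun σ => ?_, fun X σ => ?_⟩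
      · rw [prod_Iic_succ, ← mul_assoc]
        gcongr
        exact hle σ
      · rw [partialProd_succ, partialProd_update_of_le b i X le_rfl, Function.update_self]
    · obtain ⟨n, A, M, hn, hM, hA, hle, hX⟩ := ih (Fin.succ_le_castSucc_iff.2 hij)
      have h1 := hA.step j.succ Fin.coeSucc_eq_succ.symm
      rw [cyclicOp_castSucc] at h1
      refine ⟨n + 1, _, M * ‖b j‖, ?_, by positivity, h1, fun σ => ?_, fun X σ => ?_⟩
      · simp only [Fin.val_castSucc, Fin.val_succ] at hn ⊢
        omega
      · rw [prod_Iic_succ]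
        calc _ ≤ ‖partialProd Q b i.castSucc σ‖ * (‖A σ‖ * (‖b j‖ * ‖Q j.succ σ‖)) := by
              gcongr
              exact (opNorm_comp_le _ _).trans (by gcongr; exact opNorm_comp_le _ _)
          _ = (‖partialProd Q b i.castSucc σ‖ * ‖A σ‖) * (‖b j‖ * ‖Q j.succ σ‖) := by ring
          _ ≤ (M * ∏ l ∈ Finset.Iic j.castSucc, ‖Q l σ‖) * (‖b j‖ * ‖Q j.succ σ‖) :=
              mul_le_mul_of_nonneg_right (hle σ) (by positivity)
          _ = _ := by ring
      · rw [partialProd_succ, hX, Function.update_of_ne hij.ne']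
        rfl

end Chains

/-! ### Multiple operator integrals -/

section MultipleOperatorIntegrals

open ContinuousLinearMap

variable {k : ℕ} {H : Fin (k + 1) → Type*} [∀ j, NormedAddCommGroup (H j)]
  [∀ j, InnerProductSpace ℂ (H j)] [∀ j, CompleteSpace (H j)] {S : Type*} [MeasurableSpace S]
  {ρ : Measure S} {Q : ∀ j, S → H j →L[ℂ] H j} {g : S → ℝ}

theorem isPettisIntegral_partialProd (hQ : ∀ j h, StronglyMeasurable fun σ => Q j σ h)
    (hg : Integrable g ρ) (hQg : ∀ᵐ σ ∂ρ, ∏ j, ‖Q j σ‖ ≤ g σ)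
    (b : ∀ i : Fin k, H i.succ →L[ℂ] H i.castSucc) :
    IsPettisIntegral ρ (partialProd Q b (Fin.last k))
      (pettisIntegral ρ (partialProd Q b (Fin.last k))) := by
  obtain ⟨M, hM, hle⟩ := exists_norm_partialProd_le Q b (Fin.last k)
  refine isPettisIntegral_pettisIntegral
    ((isCyclicProd_partialProd Q b 0 (Fin.last k)).stronglyMeasurable hQ) (hg.const_mul M) ?_
  filter_upwards [hQg] with σ hσ
  refine (hle σ).trans ?_
  rw [← Fin.top_eq_last, Finset.Iic_top]
  gcongr

/-- Splitting a multiple operator integral at its `i`-th factor. -/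
theorem exists_partialProd_last_update_eq (hQ : ∀ j h, StronglyMeasurable fun σ => Q j σ h)
    (hg : Integrable g ρ) (hQg : ∀ᵐ σ ∂ρ, ∏ j, ‖Q j σ‖ ≤ g σ)
    (b : ∀ i : Fin k, H i.succ →L[ℂ] H i.castSucc) (b' : H 0 →L[ℂ] H (Fin.last k)) (i : Fin k) :
    ∃ (C : S → H i.castSucc →L[ℂ] H 0) (A : S → H (Fin.last k) →L[ℂ] H i.succ) (M : ℝ),
      (∀ z, StronglyMeasurable fun σ => C σ z) ∧ (∀ z, StronglyMeasurable fun σ => A σ z) ∧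
      (∀ᵐ σ ∂ρ, ‖C σ‖ * ‖A σ‖ ≤ M * g σ) ∧
      (∀ X, partialProd Q (Function.update b i X) (Fin.last k) = fun σ => C σ ∘L X ∘L A σ) ∧
      IsCyclicProd Q (cyclicOp b b') k i.succ i.castSucc (fun σ => A σ ∘L b' ∘L C σ) ∧
      IsPettisIntegral ρ (fun σ => A σ ∘L b' ∘L C σ)
        (pettisIntegral ρ fun σ => A σ ∘L b' ∘L C σ) := by
  obtain ⟨n, A, M, hn, hM, hA, hle, hX⟩ :=
    exists_partialProd_update_eq Q b b' i (Fin.le_last i.succ)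
  have hC := isCyclicProd_partialProd Q b b' i.castSucc
  have hCm := hC.stronglyMeasurable hQ
  have hAm := hA.stronglyMeasurable hQ
  have hle' : ∀ᵐ σ ∂ρ, ‖partialProd Q b i.castSucc σ‖ * ‖A σ‖ ≤ M * g σ := by
    filter_upwards [hQg] with σ hσ
    refine (hle σ).trans ?_
    rw [← Fin.top_eq_last, Finset.Iic_top]
    gcongr
  refine ⟨_, A, M, hCm, hAm, hle', fun X => funext (hX X), ?_, ?_⟩
  -- `A` ends at the last index and `C` starts at `0`, so they are joined through `b'`. The lengths
  -- `n` and `i` and the joining step add up to `n + i + 1 = k`.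
  · have h1 := hA.trans (Fin.last_add_one k).symm hC
    rw [cyclicOp_last] at h1
    rw [Fin.val_last] at hn
    rwa [Fin.val_castSucc, hn] at h1
  · refine isPettisIntegral_pettisIntegral (fun z => stronglyMeasurable_apply hAm
      (b'.continuous.comp_stronglyMeasurable (hCm z))) ((hg.const_mul M).const_mul ‖b'‖) ?_
    filter_upwards [hle'] with σ hσ
    calc _ ≤ ‖A σ‖ * (‖b'‖ * ‖partialProd Q b i.castSucc σ‖) :=
          (opNorm_comp_le _ _).trans (by gcongr; exact opNorm_comp_le _ _)
      _ = ‖b'‖ * (‖partialProd Q b i.castSucc σ‖ * ‖A σ‖) := by ring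
      _ ≤ _ := by gcongr

/-- The case split is on the operator at which the cycle is cut. Cutting at the last one gives the
original integrand; cutting at `b i` gives `A σ ∘L b' ∘L C σ` from the splitting at `i`. By
`IsCyclicProd.unique`, `F` must be that product. -/
theorem opTrace_partialProd_comp_eq (hQ : ∀ j h, StronglyMeasurable fun σ => Q j σ h)
    (hg : Integrable g ρ) (hQg : ∀ᵐ σ ∂ρ, ∏ j, ‖Q j σ‖ ≤ g σ)
    (b : ∀ i : Fin k, H i.succ →L[ℂ] H i.castSucc) {b' : H 0 →L[ℂ] H (Fin.last k)}
    (hb' : IsTraceClass b') {l m : Fin (k + 1)} (h : m = l + 1) {F : S → H l →L[ℂ] H m}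
    (hF : IsCyclicProd Q (cyclicOp b b') k m l F) :
    IsPettisIntegral ρ F (pettisIntegral ρ F) ∧
    IsTraceClass (pettisIntegral ρ F ∘L cyclicOp b b' l m h) ∧
    opTrace (pettisIntegral ρ (partialProd Q b (Fin.last k)) ∘L b') =
      opTrace (pettisIntegral ρ F ∘L cyclicOp b b' l m h) := by
  induction l using Fin.lastCases with
  | last =>
    obtain rfl : m = 0 := h.trans (Fin.last_add_one k)
    obtain rfl := hF.unique (isCyclicProd_partialProd Q b b' (Fin.last k))
    obtain ⟨x, y, hxy⟩ := hb'.exists_nuclearRep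
    rw [cyclicOp_last]
    exact ⟨isPettisIntegral_partialProd hQ hg hQg b, (hxy.comp_left _).isTraceClass, rfl⟩
  | cast i =>
    obtain rfl : m = i.succ := h.trans Fin.coeSucc_eq_succ
    obtain ⟨C, A, M, hC, hA, hle, hX, hchain, hW⟩ :=
      exists_partialProd_last_update_eq hQ hg hQg b b' i
    obtain rfl := hF.unique hchain
    obtain ⟨x, y, hxy⟩ := (hW.isTraceClass hb' (hg.const_mul M) (by
      simpa only [mul_comm] using hle)).exists_nuclearRep
    rw [cyclicOp_castSucc]
    refine ⟨hW, (hxy.comp_right _).isTraceClass, ?_⟩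
    have h1 := isPettisIntegral_partialProd hQ hg hQg b
    have h2 := hX (b i)
    rw [Function.update_eq_self] at h2
    -- `opTrace_pettis_comp` places `b i` to the left of the trace class integral, whereas here it
    -- stands on the right.
    rw [hxy.opTrace_comp_comm]
    rw [h2] at h1 ⊢
    exact opTrace_pettis_comp hC hA (hg.const_mul M) hle (b i) hb' h1 hW

theorem exists_multilinearMap_partialProd (hQ : ∀ j h, StronglyMeasurable fun σ => Q j σ h)
    (hg : Integrable g ρ) (hQg : ∀ᵐ σ ∂ρ, ∏ j, ‖Q j σ‖ ≤ g σ) :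
    ∃ M : MultilinearMap ℂ (fun i : Fin k => H i.succ →L[ℂ] H i.castSucc)
      (H (Fin.last k) →L[ℂ] H 0),
      ∀ b, M b = pettisIntegral ρ (partialProd Q b (Fin.last k)) := by
  have hI := isPettisIntegral_partialProd hQ hg hQg
  refine ⟨⟨fun b => pettisIntegral ρ (partialProd Q b (Fin.last k)), fun b i X Y => ?_,
    fun b i c X => ?_⟩, fun b => rfl⟩
  · rename_i inst
    -- Multilinearity is stated for an arbitrary decidability instance, while the splitting lemma
    -- uses the standard one.
    obtain rfl : inst = instDecidableEqFin k := Subsingleton.elim _ _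
    -- The closing operator plays no role in linearity, so it is taken to be `0`.
    obtain ⟨C, A, -, -, -, -, hX, -⟩ := exists_partialProd_last_update_eq hQ hg hQg b 0 i
    refine (hI _).unique ?_
    convert (hI (Function.update b i X)).add (hI (Function.update b i Y)) using 2 with σ
    simp [hX]
  · rename_i inst
    obtain rfl : inst = instDecidableEqFin k := Subsingleton.elim _ _
    obtain ⟨C, A, -, -, -, -, hX, -⟩ := exists_partialProd_last_update_eq hQ hg hQg b 0 i
    refine (hI _).unique ?_
    convert (hI (Function.update b i X)).smul c using 2 with σ
    simp [hX]

/-- Composing with `Tr(· B)` gives `X ↦ Tr(X W)` for a fixed trace class `W`, which is one of the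
functionals defining the topology on the source. -/
theorem continuous_ultraweak_partialProd (hQ : ∀ j h, StronglyMeasurable fun σ => Q j σ h)
    (hg : Integrable g ρ) (hQg : ∀ᵐ σ ∂ρ, ∏ j, ‖Q j σ‖ ≤ g σ)
    (b : ∀ i : Fin k, H i.succ →L[ℂ] H i.castSucc) (i : Fin k) :
    @Continuous (H i.succ →L[ℂ] H i.castSucc) (H (Fin.last k) →L[ℂ] H 0)
      (ultraweakTopology (H i.succ) (H i.castSucc)) (ultraweakTopology (H (Fin.last k)) (H 0))
      fun X => pettisIntegral ρ (partialProd Q (Function.update b i X) (Fin.last k)) := by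
  refine continuous_iInf_rng.2 fun B => continuous_induced_rng.2 ?_
  obtain ⟨C, A, M, hC, hA, hle, hX, -, hW⟩ :=
    exists_partialProd_last_update_eq hQ hg hQg b B.1 i
  have hWt := hW.isTraceClass B.2 (hg.const_mul M) (by simpa only [mul_comm] using hle)
  have heq : ((fun Y : H (Fin.last k) →L[ℂ] H 0 => opTrace (Y ∘L B.1)) ∘ fun X =>
      pettisIntegral ρ (partialProd Q (Function.update b i X) (Fin.last k))) =
      fun X => opTrace (X ∘L pettisIntegral ρ fun σ => A σ ∘L B.1 ∘L C σ) := by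
    ext1 X
    have h1 := isPettisIntegral_partialProd hQ hg hQg (Function.update b i X)
    simp only [Function.comp_apply]
    rw [hX] at h1 ⊢
    exact opTrace_pettis_comp hC hA (hg.const_mul M) hle X B.2 h1 hW
  rw [heq]
  exact continuous_iInf_dom (i := ⟨_, hWt⟩) continuous_induced_dom

theorem exists_integrable_prod_norm_integral_le {Ω : Fin (k + 1) → Type*}
    [∀ j, MeasurableSpace (Ω j)] {P : ∀ j, ProjMeasure (Ω j) (H j)} {φ : (∀ j, Ω j) → ℂ}
    {φs : ∀ j, Ω j → S → ℂ} (hφ : IsIPD P φ ρ φs) :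
    ∃ g : S → ℝ, Integrable g ρ ∧
      ∀ᵐ σ ∂ρ, ∏ j, ‖(P j).integral fun ω => φs j ω σ‖ ≤ g σ := by
  obtain ⟨_, ⟨g, hg, hle, rfl⟩, hfin⟩ := sInf_lt_iff.1 hφ.upperIntegral_lt_top
  -- `g` is a measurable majorant with finite integral, supplied by the upper integral; each of the
  -- `k + 1` factors contributes a 2 from `enorm_integral_le`.
  refine ⟨fun σ => 2 ^ (k + 1) * (g σ).toReal,
    (integrable_toReal_of_lintegral_ne_top hg.aemeasurable hfin.ne).const_mul _, ?_⟩
  filter_upwards [hle, ae_lt_top hg hfin.ne] with σ hσ hσ'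
  have h1 : ∏ j, ‖(P j).integral fun ω => φs j ω σ‖ₑ ≤ 2 ^ (k + 1) * g σ := by
    calc _ ≤ ∏ j, (2 * (P j).essNorm fun ω => φs j ω σ) :=
          Finset.prod_le_prod' fun j _ => (P j).enorm_integral_le
            ((hφ.measurable j).comp measurable_prodMk_right) (hφ.essBdd j σ)
      _ = 2 ^ (k + 1) * ∏ j, (P j).essNorm fun ω => φs j ω σ := by
          simp [Finset.prod_mul_distrib]
      _ ≤ _ := by gcongr
  have h2 := ENNReal.toReal_mono (ENNReal.mul_lt_top (by simp) hσ').ne h1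
  simpa [ENNReal.toReal_prod] using h2

end MultipleOperatorIntegrals

theorem corollary4p12 {k : ℕ} {Ω : Fin (k + 1) → Type*} [∀ j, MeasurableSpace (Ω j)]
    {H : Fin (k + 1) → Type*} [∀ j, NormedAddCommGroup (H j)]
    [∀ j, InnerProductSpace ℂ (H j)] [∀ j, CompleteSpace (H j)]
    (P : ∀ j, ProjMeasure (Ω j) (H j)) (φ : (∀ j, Ω j) → ℂ)
    {S : Type*} [MeasurableSpace S] (ρ : Measure S) (φs : ∀ j, Ω j → S → ℂ)
    (hφ : IsIPD P φ ρ φs) :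
    -- the integral defining `moi P ρ φs b` exists
    (∀ b : ∀ i : Fin k, H i.succ →L[ℂ] H i.castSucc,
      IsPettisIntegral ρ (moiIntegrand P φs b) (moi P ρ φs b)) ∧
    -- cyclic invariance of the trace pairing
    (∀ (b : ∀ i : Fin k, H i.succ →L[ℂ] H i.castSucc) (b' : H 0 →L[ℂ] H (Fin.last k)),
      IsTraceClass b' → ∀ (γ : Equiv.Perm (Fin (k + 1))) (hγ : IsRotation γ),
        IsPettisIntegral ρ
          (moiIntegrand (fun j => P (γ j)) (fun j => φs (γ j)) (permOps b b' hγ))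
          (moi (fun j => P (γ j)) ρ (fun j => φs (γ j)) (permOps b b' hγ)) ∧
        IsTraceClass (moi P ρ φs b ∘L b') ∧
        IsTraceClass (moi (fun j => P (γ j)) ρ (fun j => φs (γ j)) (permOps b b' hγ) ∘L
          permOpLast b b' hγ) ∧
        opTrace (moi P ρ φs b ∘L b') =
          opTrace (moi (fun j => P (γ j)) ρ (fun j => φs (γ j)) (permOps b b' hγ) ∘L
            permOpLast b b' hγ)) ∧
    -- `k`-linearity
    (∃ M : MultilinearMap ℂ (fun i : Fin k => H i.succ →L[ℂ] H i.castSucc)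
        (H (Fin.last k) →L[ℂ] H 0), ∀ b, M b = moi P ρ φs b) ∧
    -- ultraweak continuity in each argument
    (∀ (b : ∀ i : Fin k, H i.succ →L[ℂ] H i.castSucc) (i : Fin k),
      @Continuous (H i.succ →L[ℂ] H i.castSucc) (H (Fin.last k) →L[ℂ] H 0)
        (ultraweakTopology (H i.succ) (H i.castSucc)) (ultraweakTopology (H (Fin.last k)) (H 0))
        (fun x => moi P ρ φs (Function.update b i x))) := by
  obtain ⟨g, hg, hQg⟩ := exists_integrable_prod_norm_integral_le hφ
  have hQ : ∀ j h, StronglyMeasurable fun σ => (P j).integral (fun ω => φs j ω σ) h := fun j h =>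
    (P j).stronglyMeasurable_integral (hφ.measurable j) (hφ.essBdd j) h
  -- `moiIntegrand P φs b` is by definition `partialProd` at the last index for these `Q`.
  refine ⟨isPettisIntegral_partialProd hQ hg hQg, fun b b' hb' γ hγ => ?_,
    exists_multilinearMap_partialProd hQ hg hQg, continuous_ultraweak_partialProd hQ hg hQg⟩
  -- The unrotated cut is used only for the trace class property of the original product.
  obtain ⟨-, h1, -⟩ := opTrace_partialProd_comp_eq hQ hg hQg b hb' (Fin.last_add_one k).symm
    (isCyclicProd_partialProd _ b b' (Fin.last k))
  rw [cyclicOp_last] at h1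
  obtain ⟨h2, h3, h4⟩ := opTrace_partialProd_comp_eq hQ hg hQg b hb' (l := γ (Fin.last k))
    (m := γ 0) (by rw [← hγ.map_add_one, Fin.last_add_one])
    (isCyclicProd_partialProd_perm _ b b' hγ (Fin.last k))
  exact ⟨h2, h1, h3, h4⟩
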